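/- Let $0<p<1$, $q=1-p$ and $h=-p\log p-q\log q$. Let $\tilde f,\tilde g$ be entire functions with $\tilde f(z)=\tilde f(pz)+\tilde f(qz)+\tilde g(z)$ for all $z\in\mathbb C$ ($\tilde f(0)$ and $\tilde f'(0)$ are arbitrary). Let $0<\theta<\pi/2$, $\alpha<1$, $\beta\in\mathbb R$, and write $\log_+x=\log(1+x)$ and $\alpha_+=\max(\alpha,0)$. Let $G$ denote the meromorphic continuation of the Mellin transform $$\mathscr M[\tilde g-\tilde g(0);s]=\int_0^\infty(\tilde g(x)-\tilde g(0))\,x^{s-1}\,dx$$ (this is $\mathscr M[\tilde g;s]$ if $\tilde f(0)=0$, since $\tilde g(0)=-\tilde f(0)$). If $\frac{\log p}{\log q}$ is rational, write $\frac{\log p}{\log q}=\frac r\ell$ in lowest terms with $r,\ell>0$, let $\chi_k=\frac{2rk\pi i}{\log p}$, and let $$\mathscr F[G](x)=h^{-1}\sum_{k\in\mathbb Z\setminus\{0\}}G(-1+\chi_k)e^{2k\pi ix};$$ if $\frac{\log p}{\log q}$ is irrational, let $\mathscr F[G]=0$. Below, $\log$ is the principal logarithm and $\log_{1/p}z=\log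 z/\log(1/p)$. (a) Suppose that $\tilde g(z)=O(|z|^\alpha(\log_+|z|)^\beta)$ uniformly for $|z|\ge1$, $|\arg z|\le\theta$. Then $\mathscr M[\tilde g-\tilde g(0);s]$ converges absolutely for $-2<\Re s<-\alpha_+$ (in particular on $\Re s=-1$, and $G$ is this transform), and, as $|z|\to\infty$ in the sector $|\arg z|\le\theta$, $$\frac{\tilde f(z)}z=\tilde f'(0)+\frac{G(-1)}h+\mathscr F[G](r\log_{1/p}z)+o(1).$$ (b) Suppose that $c\in\mathbb C$ and $\tilde g(z)=cz+O(|z|^\alpha(\log_+|z|)^\beta)$ uniformly for $|z|\ge1$, $|\arg z|\le\theta$. Then $\mathscr M[\tilde g-\tilde g(0);s]$ converges absolutely for $-2<\Re s<-1$, its meromorphic continuation $G$ to $-2<\Re s<-\alpha_+$ exists and is analytic there except possibly at $s=-1$, the limit $c_0=\lim_{s\to-1}\bigl(G(s)+\frac c{s+1}\bigr)$ exists, and, as $|z|\to\infty$ in the sector $|\arg z|\le\theta$, $$\frac{\tilde f(z)}z=\tilde f'(0)+\frac ch\log z+h_0+\mathscr F[G](r\log_{1/p}z)+o(1),\qquad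 h_0=\frac{c_0}h+\frac{c\,(p\log^2p+q\log^2q)}{2h^2}.$$ In both cases the $o(1)$ is uniform in the closed sector, and the series $\mathscr F[G](r\log_{1/p}z)$ converges absolutely for $|\arg z|<\theta$. On the boundary rays $|\arg z|=\theta$, $\mathscr F[G](r\log_{1/p}z)$ stands for its continuous extension from $|\arg z|<\theta$, which exists and equals the sum of the series wherever that converges absolutely. -/

import Mathlib

open Filter Topology

noncomputable section

namespace Trie

/-- The entropy `h = -p log p - q log q` of the Bernoulli distribution, `q = 1 - p`. -/
def entropy (p : ℝ) : ℝ :=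
  -p * Real.log p - (1 - p) * Real.log (1 - p)

/-- `log p / log q` is rational, where `q = 1 - p`. -/
def RationalRatio (p : ℝ) : Prop :=
  ∃ ρ : ℚ, Real.log p / Real.log (1 - p) = (ρ : ℝ)

open Classical in
/-- The integer `r` for which `log p / log q = r / ℓ` in lowest terms (with `ℓ > 0`) if this ratio
is rational; if the ratio is irrational then `r` plays no role and is set to `0`. -/
def ratioNum (p : ℝ) : ℤ :=
  if hp : RationalRatio p then (Classical.choose hp).num else 0

/-- `χ_k = 2 r k π i / log p`. -/
def chi (p : ℝ) (k : ℤ) : ℂ :=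
  2 * (ratioNum p : ℂ) * (k : ℂ) * (Real.pi : ℂ) * Complex.I / (Real.log p : ℂ)

/-- The `k`-th term `G(-1 + χ_k) e^{2 k π i x}` of the Fourier series. -/
def fourierTerm (p : ℝ) (G : ℂ → ℂ) (x : ℂ) (k : ℤ) : ℂ :=
  G (-1 + chi p k) * Complex.exp (2 * (k : ℂ) * (Real.pi : ℂ) * Complex.I * x)

/-- If `log p / log q` is rational then the Fourier series of `𝓕[G]` converges absolutely at `x`.
In the irrational case there is no series and nothing is required. -/
def FourierConverges (p : ℝ) (G : ℂ → ℂ) (x : ℂ) : Prop :=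
  RationalRatio p → Summable (fun k : {k : ℤ // k ≠ 0} => fourierTerm p G x k)

open Classical in
/-- `𝓕[G](x) = h⁻¹ ∑_{k ≠ 0} G(-1 + χ_k) e^{2 k π i x}` if `log p / log q` is rational,
and `0` otherwise. -/
def periodicPart (p : ℝ) (G : ℂ → ℂ) (x : ℂ) : ℂ :=
  if RationalRatio p then
    (entropy p : ℂ)⁻¹ * ∑' k : {k : ℤ // k ≠ 0}, fourierTerm p G x k
  else 0

/-- The argument `r log_{1/p} z` (principal logarithm) at which `𝓕[G]` is evaluated. -/
def phase (p : ℝ) (z : ℂ) : ℂ :=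
  (ratioNum p : ℂ) * (Complex.log z / (Real.log (1 / p) : ℂ))

/-- The closed sector `|arg z| ≤ θ` without its vertex. -/
def sector (θ : ℝ) : Set ℂ :=
  {z | z ≠ 0 ∧ |z.arg| ≤ θ}

/-- `u(z) = O(|z|^α (log₊ |z|)^β)` uniformly for `|z| ≥ 1`, `|arg z| ≤ θ`,
where `log₊ x = log (1 + x)`. -/
def SectorBigO (θ α β : ℝ) (u : ℂ → ℂ) : Prop :=
  ∃ C : ℝ, ∀ z ∈ sector θ, 1 ≤ ‖z‖ → ‖u z‖ ≤ C * (‖z‖ ^ α * Real.log (1 + ‖z‖) ^ β)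

/-- `|z| → ∞` inside the closed sector `|arg z| ≤ θ`. -/
def sectorAtInfinity (θ : ℝ) : Filter ℂ :=
  comap (fun z : ℂ => ‖z‖) atTop ⊓ 𝓟 (sector θ)

/-- `P` is the function `z ↦ 𝓕[G](r log_{1/p} z)` on the closed sector `|arg z| ≤ θ`:
the Fourier series converges absolutely for `|arg z| < θ`, `P` is its value wherever in the
closed sector it converges absolutely, and `P` is continuous up to the two boundary rays
(so that `P` is uniquely determined on the closed sector). -/
structure IsPeriodicPart (p θ : ℝ) (G P : ℂ → ℂ) : Prop where
  continuousOn : ContinuousOn P (sector θ)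
  converges : ∀ z ∈ sector θ, |z.arg| < θ → FourierConverges p G (phase p z)
  eq : ∀ z ∈ sector θ, FourierConverges p G (phase p z) → P z = periodicPart p G (phase p z)

/-- The function `x ↦ g(x) - g(0)` on the real line; it is `g` itself if `g(0) = 0`. -/
def centered (g : ℂ → ℂ) : ℝ → ℂ :=
  fun x => g (x : ℂ) - g 0

/-- The Mellin transform of `φ` converges absolutely in the strip `a < Re s < b`, and on the strip
`a < Re s < b'` the function `G` is its meromorphic continuation (normal form: `G` is analytic
wherever the continuation has no pole). -/
structure IsMellinContinuation (φ : ℝ → ℂ) (a b b' : ℝ) (G : ℂ → ℂ) : Prop where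
  convergent : ∀ s : ℂ, a < s.re → s.re < b → MellinConvergent φ s
  eq_mellin : ∀ s : ℂ, a < s.re → s.re < b → G s = mellin φ s
  meromorphic : MeromorphicNFOn G {s : ℂ | a < s.re ∧ s.re < b'}

/-- `h₀ = c₀ / h + c (p log² p + q log² q) / (2 h²)`. -/
def hZero (p : ℝ) (c c₀ : ℂ) : ℂ :=
  c₀ / (entropy p : ℂ) +
    c * ((p * Real.log p ^ 2 + (1 - p) * Real.log (1 - p) ^ 2 : ℝ) : ℂ) /
      (2 * (entropy p : ℂ) ^ 2)

end Trie

end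

open MeasureTheory

/-! In the coordinate `w = log z` the sector becomes the strip `|Im w| ≤ θ`. After division by `z`,
the functional equation becomes a renewal equation `F(w) = p F(w + log p) + q F(w + log q) + ψ(w)`
on each horizontal line, with steps `a = -log p` and `b = -log q`. Subtracting `f(0)` and `f'(0) z`
from `f` makes `F` vanish at `-∞`. The same functional equation forces `g'(0) = 0`, so `g - g(0) =
O(z²)` at the origin. With the growth hypothesis at infinity, this gives `ψ` exponential decay in
both directions (for `c = 0`).

The renewal theorem is proved directly and uniformly over the parameter `Im w`; `comap Prod.snd
atTop` encodes this uniformity. Comparison with `arctan` bounds `F`. A limsup argument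
(`renewal_increment_le`) shows that `F(t) - F(t - a)` and `F(t) - F(t - b)` tend to `0`. Asymptotic
periods form a group, and under continuity of `ψ` on the compact family this group is closed. So it
contains the span `d` in the lattice case and all of `ℝ` in the irrational case. A weighted window
sum or integral of `F` equals the forcing accumulated up to time `t`. Since `F` is asymptotically
constant over the window, this determines it: `h F` is asymptotic to `d ∑ ψ(t + j d)` or to `∫ ψ`.

Poisson summation turns the lattice sum into a Fourier series whose coefficients are Mellin values
at `-1 + χ_k`. Contour shifts make these coefficients decay like `e^{-θ|χ_k|}`, hence absolute
convergence inside the sector. The lattice sum itself is continuous on the closed strip and supplies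
the extension to the boundary rays.

For `c ≠ 0`, subtracting `(c/h) w / (1 + e^{-w})` removes the logarithm while keeping analyticity.
The change in the transform at `0` and at `χ_k` is computed in closed form. It gives the second term
of `h₀` and the polar part `-c/(s+1)` of the continued Mellin transform. -/

theorem eventually_comap_snd_atTop {X : Type*} {Q : X × ℝ → Prop} :
    (∀ᶠ z in comap Prod.snd atTop, Q z) ↔ ∃ T : ℝ, ∀ x : X, ∀ t : ℝ, T ≤ t → Q (x, t) := by
  rw [(atTop_basis.comap Prod.snd).eventually_iff]
  constructor
  · rintro ⟨T, -, h⟩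
    exact ⟨T, fun x t ht => h ht⟩
  · rintro ⟨T, h⟩
    exact ⟨T, trivial, fun z hz => h z.1 z.2 hz⟩

/-! ### Renewal equation: comparison and vanishing increments -/

/-- A supersolution of the homogeneous renewal equation which is asymptotically nonnegative
at `-∞` is nonnegative. -/
theorem renewal_nonneg {p a b : ℝ} (hp0 : 0 < p) (hp1 : p < 1) (ha : 0 < a) (hb : 0 < b)
    {V : ℝ → ℝ} (hV : ∀ t, p * V (t - a) + (1 - p) * V (t - b) ≤ V t)
    (hbot : ∀ ε > 0, ∃ T, ∀ t ≤ T, -ε ≤ V t) (t : ℝ) : 0 ≤ V t := by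
  refine le_of_forall_pos_le_add fun ε hε => ?_
  obtain ⟨T, hT⟩ := hbot ε hε
  -- Extending the half-line by `min a b` keeps both shifted arguments in the known range. The bound
  -- does not deteriorate because the weights sum to one.
  have key : ∀ n : ℕ, ∀ t ≤ T + n * min a b, -ε ≤ V t := by
    intro n
    induction n with
    | zero => intro t ht; exact hT t (by simpa using ht)
    | succ n ih =>
      intro t ht
      push_cast at ht
      have h1 := ih (t - a) (by linarith [min_le_left a b])
      have h2 := ih (t - b) (by linarith [min_le_right a b])
      nlinarith [hV t]
  obtain ⟨n, hn⟩ := exists_nat_ge ((t - T) / min a b)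
  have hm : 0 < min a b := lt_min ha hb
  rw [div_le_iff₀ hm] at hn
  linarith [key n t (by linarith)]

/-- The derivative of `arctan` is comparable to `1 / (1 + t²)` throughout a step of length `a`.
Hence a multiple of `arctan` is a bounded supersolution for any forcing of that size. -/
theorem arctan_sub_lower {a : ℝ} (ha : 0 < a) :
    ∃ k > 0, ∀ t : ℝ, k / (1 + t ^ 2) ≤ Real.arctan t - Real.arctan (t - a) := by
  refine ⟨a / (2 + 2 * a ^ 2), by positivity, fun t => ?_⟩
  obtain ⟨ξ, hξ, h⟩ := exists_hasDerivAt_eq_slope Real.arctan (fun x => 1 / (1 + x ^ 2))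
    (show t - a < t by linarith) Real.continuous_arctan.continuousOn
    (fun x _ => Real.hasDerivAt_arctan x)
  rw [sub_sub_cancel, eq_div_iff ha.ne'] at h
  rw [← h, div_div, one_div, inv_mul_eq_div]
  refine div_le_div_of_nonneg_left ha.le (by positivity) ?_
  have : ξ ^ 2 ≤ 2 * t ^ 2 + 2 * a ^ 2 := by
    have h1 : (t - ξ) ^ 2 ≤ a ^ 2 := by
      apply sq_le_sq' <;> linarith [hξ.1, hξ.2]
    nlinarith [sq_nonneg (2 * t - ξ)]
  nlinarith [sq_nonneg (a * t)]

/-- Solutions of the renewal equation vanishing at `-∞` are bounded by the size of the forcing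
term. -/
theorem renewal_bound {p a b : ℝ} (hp0 : 0 < p) (hp1 : p < 1) (ha : 0 < a) (hb : 0 < b) :
    ∃ A > 0, ∀ (F ψ : ℝ → ℂ) (K : ℝ),
      (∀ t, F t = p * F (t - a) + (1 - p : ℝ) * F (t - b) + ψ t) →
      (∀ t, ‖ψ t‖ ≤ K / (1 + t ^ 2)) → Tendsto F atBot (𝓝 0) → ∀ t, ‖F t‖ ≤ A * K := by
  obtain ⟨k₁, hk₁, h₁⟩ := arctan_sub_lower ha
  obtain ⟨k₂, hk₂, h₂⟩ := arctan_sub_lower hb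
  have hk : 0 < p * k₁ + (1 - p) * k₂ := by nlinarith
  refine ⟨Real.pi / (p * k₁ + (1 - p) * k₂), by positivity, fun F ψ K hF hψ h0 t => ?_⟩
  have hK : 0 ≤ K := by simpa using (norm_nonneg _).trans (hψ 0)
  set m := K / (p * k₁ + (1 - p) * k₂) with hm
  have hm0 : 0 ≤ m := by positivity
  have hmk : m * (p * k₁ + (1 - p) * k₂) = K := by rw [hm]; field_simp
  -- Adding `π / 2` makes the barrier nonnegative. The factor `m` makes its one-step gain at least
  -- `K / (1 + t²)`.
  have := renewal_nonneg (V := fun t => m * (Real.arctan t + Real.pi / 2) - ‖F t‖)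
    hp0 hp1 ha hb (fun t => ?_) (fun ε hε => ?_) t
  · have h3 := Real.arctan_lt_pi_div_two t
    calc ‖F t‖ ≤ m * (Real.arctan t + Real.pi / 2) := by linarith
      _ ≤ m * Real.pi := by gcongr; linarith
      _ = _ := by rw [hm]; ring
  · have h3 : ‖F t‖ ≤ p * ‖F (t - a)‖ + (1 - p) * ‖F (t - b)‖ + K / (1 + t ^ 2) := by
      calc ‖F t‖ ≤ ‖(p : ℂ) * F (t - a)‖ + ‖((1 - p : ℝ) : ℂ) * F (t - b)‖ + ‖ψ t‖ := by
            rw [hF t]; exact norm_add₃_le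
        _ ≤ _ := by
            rw [norm_mul, norm_mul, Complex.norm_of_nonneg hp0.le,
              Complex.norm_of_nonneg (by linarith)]
            gcongr
            exact hψ t
    have h4 : K / (1 + t ^ 2) ≤ m * (p * (Real.arctan t - Real.arctan (t - a)) +
        (1 - p) * (Real.arctan t - Real.arctan (t - b))) := by
      rw [← hmk, mul_div_assoc]
      refine mul_le_mul_of_nonneg_left ?_ hm0
      rw [add_div, mul_div_assoc, mul_div_assoc]
      exact add_le_add (mul_le_mul_of_nonneg_left (h₁ t) hp0.le)
        (mul_le_mul_of_nonneg_left (h₂ t) (by linarith))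
    linarith
  · obtain ⟨T, hT⟩ := eventually_atBot.1
      (h0.norm.eventually (Iio_mem_nhds (by simpa using hε)))
    refine ⟨T, fun t ht => ?_⟩
    have h5 : ‖F t‖ < ε := hT t ht
    have : 0 ≤ m * (Real.arctan t + Real.pi / 2) :=
      mul_nonneg hm0 (by linarith [Real.neg_pi_div_two_lt_arctan t])
    linarith

/-- Let `s` be the uniform limsup of the increment `D`, and suppose `s > 0`. `D` solves the renewal
equation with vanishing forcing and eventually hardly exceeds `s`, so where `D` is close to `s`, it
is also close to `s` one step `a` earlier. Iterating gives arbitrarily many consecutive increments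
above `s / 2`; their telescoping sum contradicts the bound on `F`. -/
theorem renewal_increment_le {X : Type*} {p a b M : ℝ} (hp0 : 0 < p) (hp1 : p < 1)
    {F ψ : X → ℝ → ℝ}
    (hF : ∀ x t, F x t = p * F x (t - a) + (1 - p) * F x (t - b) + ψ x t)
    (hM : ∀ x t, |F x t| ≤ M)
    (hψ : Tendsto (fun z : X × ℝ => ψ z.1 z.2) (comap Prod.snd atTop) (𝓝 0))
    {ε : ℝ} (hε : 0 < ε) : ∃ T, ∀ x, ∀ t ≥ T, F x t - F x (t - a) ≤ ε := by
  rcases isEmpty_or_nonempty X with hX | ⟨⟨x₀⟩⟩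
  · exact ⟨0, fun x => (hX.false x).elim⟩
  set D : X → ℝ → ℝ := fun x t => F x t - F x (t - a) with hD
  have hDM : ∀ x t, |D x t| ≤ 2 * M := fun x t =>
    (abs_sub _ _).trans (by linarith [hM x t, hM x (t - a)])
  have hM0 : 0 ≤ M := (abs_nonneg _).trans (hM x₀ 0)
  set S : Set ℝ := {σ | ∃ T, ∀ x, ∀ t ≥ T, D x t ≤ σ} with hS
  have hSne : S.Nonempty := ⟨2 * M, 0, fun x t _ => (le_abs_self _).trans (hDM x t)⟩
  have hSbdd : BddBelow S := ⟨-(2 * M), by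
    rintro σ ⟨T, hT⟩
    exact (neg_le_of_abs_le (hDM x₀ T)).trans (hT x₀ T le_rfl)⟩
  set s := sInf S with hs
  have hlt : ∀ σ, s < σ → ∃ T, ∀ x, ∀ t ≥ T, D x t ≤ σ := fun σ hσ => by
    obtain ⟨σ', ⟨T, hT⟩, h'⟩ := exists_lt_of_csInf_lt hSne hσ
    exact ⟨T, fun x t ht => (hT x t ht).trans h'.le⟩
  rcases le_or_gt s 0 with hs0 | hs0
  · exact hlt ε (by linarith)
  exfalso
  have hη : ∀ ε > 0, ∃ T, ∀ x, ∀ t ≥ T, ψ x t - ψ x (t - a) ≤ ε := by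
    intro ε hε
    obtain ⟨T, hT⟩ := eventually_comap_snd_atTop.1
      (hψ.eventually (Metric.ball_mem_nhds 0 (half_pos hε)))
    refine ⟨max T (T + a), fun x t ht => ?_⟩
    have h1 := hT x t (le_of_max_le_left ht)
    have h2 := hT x (t - a) (by linarith [le_of_max_le_right ht])
    simp only [dist_zero_right, Real.norm_eq_abs] at h1 h2
    linarith [(abs_lt.1 h1).2, (abs_lt.1 h2).1]
  have hDeq : ∀ x t, D x t = p * D x (t - a) + (1 - p) * D x (t - b) +
      (ψ x t - ψ x (t - a)) := by
    intro x t
    simp only [hD]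
    rw [hF x t, hF x (t - a), show t - b - a = t - a - b by ring]
    ring
  have key : ∀ k : ℕ, ∀ ε > 0, ∀ T, ∃ x, ∃ t ≥ T, ∀ j ≤ k, s - ε ≤ D x (t - j * a) := by
    intro k
    induction k with
    | zero =>
      intro ε hε T
      by_contra! hcon
      have : s - ε ∈ S := ⟨T, fun x t ht => by
        obtain ⟨j, hj, h⟩ := hcon x t ht
        obtain rfl : j = 0 := by omega
        simpa using h.le⟩
      linarith [csInf_le hSbdd this]
    | succ k ih =>
      intro ε hε T
      -- Three errors enter: the deficit of `D`, its excess over `s` at the `b`-shifted point, and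
      -- the forcing. Together they cost at most `p ε`, and dividing by the weight `p` leaves `ε`.
      have hε' : 0 < p * ε / 3 := by positivity
      obtain ⟨T₁, hT₁⟩ := hlt (s + p * ε / 3) (by linarith)
      obtain ⟨T₂, hT₂⟩ := hη _ hε'
      obtain ⟨x, t, ht, h⟩ := ih _ hε' (max T (max (T₁ + b + k * a) (T₂ + k * a)))
      have ht1 := (le_max_left _ _).trans ((le_max_right _ _).trans ht)
      have ht2 := (le_max_right _ _).trans ((le_max_right _ _).trans ht)
      refine ⟨x, t, (le_max_left _ _).trans ht, fun j hj => ?_⟩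
      rcases Nat.lt_or_ge j (k + 1) with hj' | hj'
      · have := h j (by omega)
        nlinarith
      · obtain rfl : j = k + 1 := by omega
        have h1 := h k le_rfl
        rw [hDeq] at h1
        have h2 := hT₁ x (t - k * a - b) (by linarith)
        have h3 := hT₂ x (t - k * a) (by linarith)
        have h4 : t - ((k + 1 : ℕ) : ℝ) * a = t - k * a - a := by push_cast; ring
        rw [h4]
        have h5 : (1 - p) * D x (t - k * a - b) ≤ (1 - p) * (s + p * ε / 3) :=
          mul_le_mul_of_nonneg_left h2 (by linarith)
        have h6 : p * (s - ε) ≤ p * D x (t - k * a - a) := by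
          nlinarith [mul_pos hp0 (mul_pos hp0 hε)]
        exact le_of_mul_le_mul_left h6 hp0
  -- `N` increments of size `s / 2` exceed the largest possible oscillation `2 M`.
  obtain ⟨N, hN⟩ := exists_nat_gt (2 * M / (s / 2))
  rw [div_lt_iff₀ (by linarith)] at hN
  obtain ⟨x, t, -, h⟩ := key N (s / 2) (by linarith) 0
  have hsum : ∑ j ∈ Finset.range N, D x (t - j * a) = F x t - F x (t - N * a) := by
    have := Finset.sum_range_sub' (fun j : ℕ => F x (t - j * a)) N
    simp only [Nat.cast_zero, zero_mul, sub_zero] at this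
    rw [← this]
    refine Finset.sum_congr rfl fun j _ => ?_
    simp only [hD]
    push_cast
    ring_nf
  have h1 : N * (s / 2) ≤ ∑ j ∈ Finset.range N, D x (t - j * a) := by
    calc (N : ℝ) * (s / 2) = ∑ j ∈ Finset.range N, s / 2 := by simp
      _ ≤ _ := Finset.sum_le_sum fun j hj => by
        have := h j (Finset.mem_range.1 hj).le
        linarith
  rw [hsum] at h1
  linarith [le_abs_self (F x t), neg_abs_le (F x (t - N * a)), hM x t, hM x (t - N * a)]

theorem renewal_increment_tendsto_real {X : Type*} {p a b M : ℝ} (hp0 : 0 < p) (hp1 : p < 1)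
    {F ψ : X → ℝ → ℝ}
    (hF : ∀ x t, F x t = p * F x (t - a) + (1 - p) * F x (t - b) + ψ x t)
    (hM : ∀ x t, |F x t| ≤ M)
    (hψ : Tendsto (fun z : X × ℝ => ψ z.1 z.2) (comap Prod.snd atTop) (𝓝 0)) :
    Tendsto (fun z : X × ℝ => F z.1 z.2 - F z.1 (z.2 - a)) (comap Prod.snd atTop) (𝓝 0) := by
  rw [Metric.tendsto_nhds]
  intro ε hε
  rw [eventually_comap_snd_atTop]
  obtain ⟨T₁, h₁⟩ := renewal_increment_le hp0 hp1 hF hM hψ (half_pos hε)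
  obtain ⟨T₂, h₂⟩ := renewal_increment_le (F := fun x t => -F x t) (ψ := fun x t => -ψ x t)
    (a := a) (b := b) hp0 hp1 (fun x t => by rw [hF x t]; ring) (fun x t => by simpa using hM x t)
    (by simpa using hψ.neg) (half_pos hε)
  refine ⟨max T₁ T₂, fun x t ht => ?_⟩
  have h3 := h₁ x t (le_of_max_le_left ht)
  have h4 := h₂ x t (le_of_max_le_right ht)
  rw [dist_zero_right, Real.norm_eq_abs, abs_lt]
  constructor <;> dsimp only <;> linarith

/-- Increments of a bounded solution of the renewal equation by the first step tend to `0`. -/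
theorem renewal_increment_tendsto {X : Type*} {p a b M : ℝ} (hp0 : 0 < p) (hp1 : p < 1)
    {F ψ : X → ℝ → ℂ}
    (hF : ∀ x t, F x t = p * F x (t - a) + (1 - p : ℝ) * F x (t - b) + ψ x t)
    (hM : ∀ x t, ‖F x t‖ ≤ M)
    (hψ : Tendsto (fun z : X × ℝ => ψ z.1 z.2) (comap Prod.snd atTop) (𝓝 0)) :
    Tendsto (fun z : X × ℝ => F z.1 z.2 - F z.1 (z.2 - a)) (comap Prod.snd atTop) (𝓝 0) := by
  have hre := renewal_increment_tendsto_real (F := fun x t => (F x t).re)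
    (ψ := fun x t => (ψ x t).re) (a := a) (b := b) hp0 hp1 (fun x t => by rw [hF x t]; simp)
    (fun x t => (Complex.abs_re_le_norm _).trans (hM x t))
    (by simpa [Function.comp_def] using (Complex.continuous_re.tendsto 0).comp hψ)
  have him := renewal_increment_tendsto_real (F := fun x t => (F x t).im)
    (ψ := fun x t => (ψ x t).im) (a := a) (b := b) hp0 hp1 (fun x t => by rw [hF x t]; simp)
    (fun x t => (Complex.abs_im_le_norm _).trans (hM x t))
    (by simpa [Function.comp_def] using (Complex.continuous_im.tendsto 0).comp hψ)
  rw [tendsto_zero_iff_norm_tendsto_zero]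
  refine squeeze_zero (fun _ => norm_nonneg _) (fun z => Complex.norm_le_abs_re_add_abs_im _) ?_
  simpa using hre.abs.add him.abs

/-! ### Estimates for exponentially decaying functions -/

theorem exp_neg_mul_abs_le {κ : ℝ} (hκ : 0 < κ) :
    ∃ K > 0, ∀ t : ℝ, Real.exp (-κ * |t|) ≤ K / (1 + t ^ 2) := by
  refine ⟨1 + 2 / κ ^ 2, by positivity, fun t => ?_⟩
  rw [le_div_iff₀ (by positivity), neg_mul, Real.exp_neg, inv_mul_le_iff₀ (Real.exp_pos _)]
  have h1 := Real.quadratic_le_exp_of_nonneg (show 0 ≤ κ * |t| by positivity)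
  have h2 : κ ^ 2 * t ^ 2 * (2 / κ ^ 2) = 2 * t ^ 2 := by field_simp
  have h3 : 1 + κ ^ 2 * t ^ 2 / 2 ≤ Real.exp (κ * |t|) := by
    rw [mul_pow, sq_abs] at h1
    nlinarith [abs_nonneg t]
  have h4 : 0 < 2 / κ ^ 2 := by positivity
  nlinarith [sq_nonneg (κ * t)]

theorem integrable_exp_neg_mul_abs {κ : ℝ} (hκ : 0 < κ) :
    Integrable (fun t : ℝ => Real.exp (-κ * |t|)) := by
  obtain ⟨K, hK, h⟩ := exp_neg_mul_abs_le hκ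
  refine (integrable_inv_one_add_sq.const_mul K).mono' (by fun_prop) (ae_of_all _ fun t => ?_)
  rw [Real.norm_of_nonneg (Real.exp_pos _).le, ← div_eq_mul_inv]
  exact h t

theorem summable_pow_natAbs {r : ℝ} (hr0 : 0 ≤ r) (hr1 : r < 1) :
    Summable (fun j : ℤ => r ^ j.natAbs) := by
  rw [summable_int_iff_summable_nat_and_neg]
  simpa using summable_geometric_of_lt_one hr0 hr1

theorem exp_neg_mul_abs_add_int_le {κ d : ℝ} (hκ : 0 ≤ κ) (hd : 0 ≤ d) (t : ℝ) (j : ℤ) :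
    Real.exp (-κ * |t + j * d|) ≤ Real.exp (κ * |t|) * Real.exp (-κ * d) ^ j.natAbs := by
  rw [← Real.exp_nat_mul, ← Real.exp_add, Real.exp_le_exp]
  have h1 : ((j.natAbs : ℕ) : ℝ) = |(j : ℝ)| := by rw [Nat.cast_natAbs]; simp
  have h2 : |(j : ℝ) * d| ≤ |t + j * d| + |t| := by
    have := abs_sub (t + j * d) t
    rwa [add_sub_cancel_left] at this
  rw [abs_mul, abs_of_nonneg hd] at h2
  rw [h1]
  nlinarith

theorem summable_exp_neg_mul_abs_add_int {κ d : ℝ} (hκ : 0 < κ) (hd : 0 < d) (t : ℝ) :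
    Summable (fun j : ℤ => Real.exp (-κ * |t + j * d|)) :=
  ((summable_pow_natAbs (Real.exp_pos _).le
    (Real.exp_lt_one_iff.2 (by nlinarith))).mul_left (Real.exp (κ * |t|))).of_nonneg_of_le
    (fun _ => (Real.exp_pos _).le) (exp_neg_mul_abs_add_int_le hκ.le hd.le t)

theorem tendsto_exp_neg_mul_abs {X : Type*} {κ : ℝ} (hκ : 0 < κ) (C : ℝ) :
    Tendsto (fun z : X × ℝ => C * Real.exp (-κ * |z.2|)) (comap Prod.snd atTop) (𝓝 0) := by
  have h : Tendsto (fun t : ℝ => C * Real.exp (-κ * |t|)) atTop (𝓝 (C * 0)) :=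
    (Real.tendsto_exp_atBot.comp
      (tendsto_abs_atTop_atTop.const_mul_atTop_of_neg (neg_neg_of_pos hκ))).const_mul C
  rw [mul_zero] at h
  exact h.comp tendsto_comap

/-! ### Families of renewal equations and asymptotic periods -/

/-- A family of solutions of the renewal equation with step `a` of probability `p` and step `b` of
probability `1 - p`, vanishing at `-∞`, with exponentially decaying forcing terms. -/
structure RenewalFamily {X : Type*} (p a b κ C : ℝ) (F ψ : X → ℝ → ℂ) : Prop where
  p_pos : 0 < p
  p_lt_one : p < 1
  a_pos : 0 < a
  b_pos : 0 < b
  κ_pos : 0 < κ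
  eq : ∀ x t, F x t = p * F x (t - a) + (1 - p : ℝ) * F x (t - b) + ψ x t
  decay : ∀ x t, ‖ψ x t‖ ≤ C * Real.exp (-κ * |t|)
  bot : ∀ x, Tendsto (F x) atBot (𝓝 0)

/-- The translations under which `F` is asymptotically invariant at `+∞`. -/
def asymptoticPeriods {X : Type*} (F : X → ℝ → ℂ) : AddSubgroup ℝ where
  carrier := {τ | Tendsto (fun z : X × ℝ => F z.1 z.2 - F z.1 (z.2 - τ))
    (comap Prod.snd atTop) (𝓝 0)}
  zero_mem' := by simpa using tendsto_const_nhds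
  add_mem' := by
    intro σ τ hσ hτ
    have hs : Tendsto (fun z : X × ℝ => (z.1, z.2 - σ)) (comap Prod.snd atTop)
        (comap Prod.snd atTop) :=
      tendsto_comap_iff.2 ((tendsto_atTop_add_const_right _ (-σ) tendsto_id).comp tendsto_comap)
    have := Tendsto.add hσ (Tendsto.comp hτ hs)
    simp only [add_zero, Function.comp_def, sub_add_sub_cancel, sub_sub] at this
    exact this
  neg_mem' := by
    intro σ hσ
    have hs : Tendsto (fun z : X × ℝ => (z.1, z.2 + σ)) (comap Prod.snd atTop)
        (comap Prod.snd atTop) :=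
      tendsto_comap_iff.2 ((tendsto_atTop_add_const_right _ σ tendsto_id).comp tendsto_comap)
    have := (Tendsto.comp hσ hs).neg
    simp only [neg_zero, Function.comp_def, neg_sub, add_sub_cancel_right] at this
    simpa only [Set.mem_ofPred_eq, sub_neg_eq_add] using this

namespace RenewalFamily

variable {X : Type*} {p a b κ C : ℝ} {F ψ : X → ℝ → ℂ}

theorem tendsto_forcing (h : RenewalFamily p a b κ C F ψ) :
    Tendsto (fun z : X × ℝ => ψ z.1 z.2) (comap Prod.snd atTop) (𝓝 0) :=
  squeeze_zero_norm (fun z => h.decay z.1 z.2) (tendsto_exp_neg_mul_abs h.κ_pos C)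

theorem exists_bound (h : RenewalFamily p a b κ C F ψ) : ∃ M, ∀ x t, ‖F x t‖ ≤ M := by
  obtain ⟨K, hK, hexp⟩ := exp_neg_mul_abs_le h.κ_pos
  obtain ⟨A, hA, hb⟩ := renewal_bound h.p_pos h.p_lt_one h.a_pos h.b_pos
  refine ⟨A * (|C| * K), fun x => hb (F x) (ψ x) _ (h.eq x) (fun t => ?_) (h.bot x)⟩
  calc ‖ψ x t‖ ≤ C * Real.exp (-κ * |t|) := h.decay x t
    _ ≤ |C| * (K / (1 + t ^ 2)) := by
      gcongr
      · exact le_abs_self C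
      · exact hexp t
    _ = _ := by ring

theorem closure_le_asymptoticPeriods (h : RenewalFamily p a b κ C F ψ) :
    AddSubgroup.closure {a, b} ≤ asymptoticPeriods F := by
  obtain ⟨M, hM⟩ := h.exists_bound
  rw [AddSubgroup.closure_le, Set.insert_subset_iff, Set.singleton_subset_iff]
  refine ⟨renewal_increment_tendsto h.p_pos h.p_lt_one h.eq hM h.tendsto_forcing,
    -- The equation is symmetric under exchanging `(p, a)` with `(1 - p, b)`.
    renewal_increment_tendsto (p := 1 - p) (a := b) (b := a) (by linarith [h.p_lt_one])
      (by linarith [h.p_pos]) (fun x t => ?_) hM h.tendsto_forcing⟩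
  rw [h.eq x t]
  push_cast
  ring

/-! ### The lattice renewal theorem -/

theorem summable_forcing (h : RenewalFamily p a b κ C F ψ) {d : ℝ} (hd : 0 < d) (x : X) (t : ℝ) :
    Summable (fun j : ℤ => ψ x (t + j * d)) :=
  ((summable_exp_neg_mul_abs_add_int h.κ_pos hd t).mul_left C).of_norm_bounded
    (fun _ => h.decay x _)

/-- By the renewal equation, the window functional `E` satisfies `E(t) - E(t - d) = ψ(t)`.
Telescoping back to `-∞`, where `E` vanishes, sums the past forcing. -/
theorem hasSum_window (h : RenewalFamily p a b κ C F ψ) {d : ℝ} (hd : 0 < d) {r l : ℕ}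
    (har : a = r * d) (hbl : b = l * d) (x : X) (t : ℝ) :
    HasSum (fun j : ℕ => ψ x (t - j * d))
      (p * ∑ j ∈ Finset.range r, F x (t - j * d) +
        (1 - p : ℝ) * ∑ j ∈ Finset.range l, F x (t - j * d)) := by
  set E : ℝ → ℂ := fun t => p * ∑ j ∈ Finset.range r, F x (t - j * d) +
        (1 - p : ℝ) * ∑ j ∈ Finset.range l, F x (t - j * d) with hE
  have hshift : ∀ (n : ℕ) (t : ℝ), ∑ j ∈ Finset.range n, F x (t - j * d) -
      ∑ j ∈ Finset.range n, F x (t - d - j * d) = F x t - F x (t - n * d) := by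
    intro n t
    rw [← Finset.sum_sub_distrib]
    have := Finset.sum_range_sub' (fun j : ℕ => F x (t - j * d)) n
    simp only [Nat.cast_zero, zero_mul, sub_zero] at this
    rw [← this]
    refine Finset.sum_congr rfl fun j _ => ?_
    push_cast
    ring_nf
  have hstep : ∀ t, E t - E (t - d) = ψ x t := by
    intro t
    have h1 := hshift r t
    have h2 := hshift l t
    have h3 := h.eq x t
    rw [har, hbl] at h3
    calc E t - E (t - d) = p * (∑ j ∈ Finset.range r, F x (t - j * d) -
          ∑ j ∈ Finset.range r, F x (t - d - j * d)) + (1 - p : ℝ) *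
          (∑ j ∈ Finset.range l, F x (t - j * d) -
          ∑ j ∈ Finset.range l, F x (t - d - j * d)) := by simp only [hE]; ring
      _ = ψ x t := by
        rw [h1, h2]
        push_cast at h3 ⊢
        linear_combination h3
  have hsum : Summable (fun j : ℕ => ‖ψ x (t - j * d)‖) := by
    refine Summable.of_nonneg_of_le (fun _ => norm_nonneg _) (fun j => h.decay x _)
      (Summable.mul_left C ?_)
    have := (summable_int_iff_summable_nat_and_neg.1
      (summable_exp_neg_mul_abs_add_int h.κ_pos hd t)).2
    simpa [sub_eq_add_neg] using this
  rw [hasSum_iff_tendsto_nat_of_summable_norm hsum]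
  have hpart : ∀ n : ℕ, ∑ j ∈ Finset.range n, ψ x (t - j * d) = E t - E (t - n * d) := by
    intro n
    have := Finset.sum_range_sub' (fun j : ℕ => E (t - j * d)) n
    simp only [Nat.cast_zero, zero_mul, sub_zero] at this
    rw [← this]
    refine Finset.sum_congr rfl fun j _ => ?_
    rw [← hstep]
    push_cast
    ring_nf
  simp_rw [hpart]
  have hbotE : Tendsto E atBot (𝓝 0) := by
    have hF : ∀ j : ℕ, Tendsto (fun t => F x (t - j * d)) atBot (𝓝 0) := fun j =>
      (h.bot x).comp (tendsto_atBot_add_const_right _ (-(j * d)) tendsto_id)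
    have := ((tendsto_finsetSum (Finset.range r) fun j _ => hF j).const_mul (p : ℂ)).add
      ((tendsto_finsetSum (Finset.range l) fun j _ => hF j).const_mul ((1 - p : ℝ) : ℂ))
    simpa [hE] using this
  have hto : Tendsto (fun n : ℕ => t - n * d) atTop atBot := by
    have := (tendsto_natCast_atTop_atTop (R := ℝ)).const_mul_atTop_of_neg (neg_neg_of_pos hd)
    refine (tendsto_atBot_add_const_left _ t this).congr fun n => by ring
  change Tendsto _ _ (𝓝 (E t))
  simpa using (hbotE.comp hto).const_sub (E t)

/-- The renewal theorem for a lattice walk of span `d`. -/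
theorem tendsto_lattice (h : RenewalFamily p a b κ C F ψ) {d : ℝ} (hd : 0 < d) {r l : ℕ}
    (har : a = r * d) (hbl : b = l * d) (hrl : r.Coprime l) :
    Tendsto (fun z : X × ℝ => ((p * r + (1 - p) * l : ℝ) : ℂ) * F z.1 z.2 -
      ∑' j : ℤ, ψ z.1 (z.2 + j * d)) (comap Prod.snd atTop) (𝓝 0) := by
  -- By Bézout, coprimality of `r` and `l` makes `d` an integer combination of `a` and `b`.
  have hdmem : d ∈ asymptoticPeriods F := by
    refine h.closure_le_asymptoticPeriods ?_
    have ha : a ∈ AddSubgroup.closure {a, b} := AddSubgroup.subset_closure (by simp)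
    have hb : b ∈ AddSubgroup.closure {a, b} := AddSubgroup.subset_closure (by simp)
    have := add_mem (zsmul_mem ha (r.gcdA l)) (zsmul_mem hb (r.gcdB l))
    have hg := Nat.gcd_eq_gcd_ab r l
    rw [hrl] at hg
    have hg' : (1 : ℝ) = r * r.gcdA l + l * r.gcdB l := by exact_mod_cast hg
    convert this using 1
    rw [zsmul_eq_mul, zsmul_eq_mul, har, hbl]
    linear_combination d * hg'
  have hjd : ∀ j : ℕ, Tendsto (fun z : X × ℝ => F z.1 z.2 - F z.1 (z.2 - j * d))
      (comap Prod.snd atTop) (𝓝 0) := fun j => by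
    have := (asymptoticPeriods F).nsmul_mem hdmem j
    rw [nsmul_eq_mul] at this
    exact this
  have hmain : Tendsto (fun z : X × ℝ => (p : ℂ) * ∑ j ∈ Finset.range r,
      (F z.1 z.2 - F z.1 (z.2 - j * d)) + (1 - p : ℝ) * ∑ j ∈ Finset.range l,
      (F z.1 z.2 - F z.1 (z.2 - j * d))) (comap Prod.snd atTop) (𝓝 0) := by
    have := ((tendsto_finsetSum (Finset.range r) fun j _ => hjd j).const_mul (p : ℂ)).add
      ((tendsto_finsetSum (Finset.range l) fun j _ => hjd j).const_mul ((1 - p : ℝ) : ℂ))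
    simpa using this
  set ρ := Real.exp (-κ * d) with hρ
  have hρ1 : ρ < 1 := Real.exp_lt_one_iff.2 (by nlinarith [h.κ_pos])
  have hgeo := summable_geometric_of_lt_one (Real.exp_pos _).le hρ1
  -- The window sum sees only the forcing up to time `t`. The lattice points ahead of `t` contribute
  -- `O(e^{-κ t})`.
  have htail : Tendsto (fun z : X × ℝ => ∑' j : ℕ, ψ z.1 (z.2 + (j + 1) * d))
      (comap Prod.snd atTop) (𝓝 0) := by
    refine squeeze_zero_norm' (a := fun z => (|C| * ∑' j : ℕ, ρ ^ j) * Real.exp (-κ * |z.2|))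
      ?_ (tendsto_exp_neg_mul_abs h.κ_pos _)
    rw [eventually_comap_snd_atTop]
    refine ⟨0, fun x t ht => ?_⟩
    have hle : ∀ j : ℕ, ‖ψ x (t + (j + 1) * d)‖ ≤ |C| * Real.exp (-κ * |t|) * ρ ^ j := by
      intro j
      refine (h.decay x _).trans ?_
      rw [mul_assoc]
      refine mul_le_mul (le_abs_self C) ?_ (Real.exp_pos _).le (abs_nonneg _)
      rw [hρ, ← Real.exp_nat_mul, ← Real.exp_add, Real.exp_le_exp,
        abs_of_nonneg (by positivity), abs_of_nonneg ht]
      nlinarith [mul_pos h.κ_pos hd]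
    have := tsum_of_norm_bounded ((hgeo.mul_left _).hasSum) hle
    refine this.trans (le_of_eq ?_)
    rw [tsum_mul_left]
    dsimp only
    ring
  have := hmain.sub htail
  rw [sub_zero] at this
  refine this.congr fun z => ?_
  have hs1 := h.hasSum_window hd har hbl z.1 z.2
  have hs2 : HasSum (fun j : ℕ => ψ z.1 (z.2 + (j + 1) * d))
      (∑' j : ℕ, ψ z.1 (z.2 + (j + 1) * d)) := by
    refine Summable.hasSum ?_
    have := ((summable_int_iff_summable_nat_and_neg.1
      (h.summable_forcing hd z.1 z.2)).1.comp_injective (add_left_injective 1))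
    simpa [Function.comp_def] using this
  have hs : HasSum (fun j : ℤ => ψ z.1 (z.2 - j * d)) _ :=
    HasSum.of_nat_of_neg_add_one (f := fun j : ℤ => ψ z.1 (z.2 - j * d))
      (by simpa using hs1) (by convert hs2 using 3; push_cast; ring)
  have hz : ∑' j : ℤ, ψ z.1 (z.2 + j * d) = ∑' j : ℤ, ψ z.1 (z.2 - j * d) := by
    rw [← (Equiv.neg ℤ).tsum_eq (fun j : ℤ => ψ z.1 (z.2 + j * d))]
    simp [sub_eq_add_neg]
  rw [hz, hs.tsum_eq]
  simp only [Finset.sum_sub_distrib, Finset.sum_const, Finset.card_range, nsmul_eq_mul]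
  push_cast
  ring

end RenewalFamily

/-! ### The nonlattice renewal theorem -/

namespace RenewalFamily

variable {X : Type*} {p a b κ C : ℝ} {F ψ : X → ℝ → ℂ}

theorem tendsto_forcing_cocompact [TopologicalSpace X] [CompactSpace X]
    (h : RenewalFamily p a b κ C F ψ) :
    Tendsto (fun z : X × ℝ => ψ z.1 z.2) (cocompact (X × ℝ)) (𝓝 0) := by
  rw [← coprod_cocompact, cocompact_eq_bot, bot_coprod]
  refine squeeze_zero_norm (fun z => h.decay z.1 z.2) ?_
  have h1 : Tendsto (fun t : ℝ => C * Real.exp (-κ * |t|)) (cocompact ℝ) (𝓝 (C * 0)) :=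
    (Real.tendsto_exp_atBot.comp
      ((tendsto_norm_cocompact_atTop (E := ℝ)).const_mul_atTop_of_neg
        (neg_neg_of_pos h.κ_pos))).const_mul C
  rw [mul_zero] at h1
  exact h1.comp tendsto_comap

/-- The difference `F(· + s) - F` solves the equation with forcing `ψ(· + s) - ψ`, so
`renewal_bound` applies if that forcing is both small and decaying. Uniform continuity of `ψ` gives
smallness and the exponential bound gives decay; their geometric mean has both, at half the rate. -/
theorem equicontinuous [PseudoMetricSpace X] [CompactSpace X]
    (h : RenewalFamily p a b κ C F ψ) (hψ : Continuous (fun z : X × ℝ => ψ z.1 z.2))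
    {ε : ℝ} (hε : 0 < ε) :
    ∃ δ > 0, ∀ s, |s| < δ → ∀ x t, ‖F x (t + s) - F x t‖ ≤ ε := by
  have hκ := h.κ_pos
  obtain ⟨K, hK, hexp⟩ := exp_neg_mul_abs_le (half_pos hκ)
  obtain ⟨A, hA, hb⟩ := renewal_bound h.p_pos h.p_lt_one h.a_pos h.b_pos
  -- For `|s| < 1` a shift costs at most a factor `e^κ`. The final `+ 1` keeps `C'` positive.
  set C' := |C| * (Real.exp κ + 1) + 1 with hC'
  have hC'0 : 0 < C' := by positivity
  set m := ε / (A * K) with hm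
  have hm0 : 0 < m := by positivity
  have huc := hψ.uniformContinuous_of_tendsto_cocompact h.tendsto_forcing_cocompact
  obtain ⟨δ, hδ, hd⟩ := Metric.uniformContinuous_iff.1 huc (m ^ 2 / C') (by positivity)
  refine ⟨min δ 1, by positivity, fun s hs x => ?_⟩
  have hs1 : |s| < 1 := hs.trans_le (min_le_right _ _)
  have := hb (fun t => F x (t + s) - F x t) (fun t => ψ x (t + s) - ψ x t) (m * K)
    (fun t => ?_) (fun t => ?_) ?_
  · intro t
    refine (this t).trans (le_of_eq ?_)
    rw [hm]
    field_simp
  · have h1 := h.eq x (t + s)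
    have h2 := h.eq x t
    rw [show t + s - a = t - a + s by ring, show t + s - b = t - b + s by ring] at h1
    linear_combination h1 - h2
  · have h1 : ‖ψ x (t + s) - ψ x t‖ ≤ m ^ 2 / C' := by
      rw [← dist_eq_norm]
      refine (@hd (x, t + s) (x, t) ?_).le
      rw [Prod.dist_eq, dist_self, Real.dist_eq, add_sub_cancel_left]
      exact max_lt hδ (hs.trans_le (min_le_left _ _))
    have h2 : ‖ψ x (t + s) - ψ x t‖ ≤ C' * Real.exp (-(κ / 2) * |t|) ^ 2 := by
      have h3 : Real.exp (-κ * |t + s|) ≤ Real.exp κ * Real.exp (-κ * |t|) := by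
        rw [← Real.exp_add, Real.exp_le_exp]
        have := abs_sub (t + s) s
        rw [add_sub_cancel_right] at this
        nlinarith
      have h4 : Real.exp (-(κ / 2) * |t|) ^ 2 = Real.exp (-κ * |t|) := by
        rw [← Real.exp_nat_mul]
        congr 1
        push_cast
        ring
      rw [h4]
      have h5 := Real.exp_pos (-κ * |t|)
      calc ‖ψ x (t + s) - ψ x t‖ ≤ ‖ψ x (t + s)‖ + ‖ψ x t‖ := norm_sub_le _ _
        _ ≤ |C| * Real.exp (-κ * |t + s|) + |C| * Real.exp (-κ * |t|) := by
          gcongr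
          · exact (h.decay x _).trans (by gcongr; exact le_abs_self C)
          · exact (h.decay x _).trans (by gcongr; exact le_abs_self C)
        _ ≤ |C| * (Real.exp κ * Real.exp (-κ * |t|)) + |C| * Real.exp (-κ * |t|) := by gcongr
        _ ≤ C' * Real.exp (-κ * |t|) := by rw [hC']; nlinarith
    have h3 : ‖ψ x (t + s) - ψ x t‖ ≤ m * Real.exp (-(κ / 2) * |t|) := by
      refine le_of_sq_le_sq ?_ (by positivity)
      calc ‖ψ x (t + s) - ψ x t‖ ^ 2
          ≤ (m ^ 2 / C') * (C' * Real.exp (-(κ / 2) * |t|) ^ 2) := by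
            rw [sq]; gcongr
        _ = _ := by field_simp
    refine h3.trans ?_
    rw [mul_div_assoc]
    gcongr
    exact hexp t
  · have h1 : Tendsto (fun t : ℝ => t + s) atBot atBot :=
      tendsto_atBot_add_const_right _ s tendsto_id
    simpa using ((h.bot x).comp h1).sub (h.bot x)

theorem isClosed_asymptoticPeriods [PseudoMetricSpace X] [CompactSpace X]
    (h : RenewalFamily p a b κ C F ψ) (hψ : Continuous (fun z : X × ℝ => ψ z.1 z.2)) :
    IsClosed (asymptoticPeriods F : Set ℝ) := by
  refine isClosed_of_closure_subset fun τ hτ => ?_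
  change Tendsto _ _ _
  rw [Metric.tendsto_nhds]
  intro ε hε
  obtain ⟨δ, hδ, hd⟩ := h.equicontinuous hψ (half_pos hε)
  obtain ⟨σ, hσ, hστ⟩ := Metric.mem_closure_iff.1 hτ δ hδ
  have hσ' : Tendsto (fun z : X × ℝ => F z.1 z.2 - F z.1 (z.2 - σ))
    (comap Prod.snd atTop) (𝓝 0) := hσ
  filter_upwards [hσ'.eventually (Metric.ball_mem_nhds 0 (half_pos hε))] with z hz
  have h1 := hd (τ - σ) (by rwa [Real.dist_eq] at hστ) z.1 (z.2 - τ)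
  rw [show z.2 - τ + (τ - σ) = z.2 - σ by ring] at h1
  rw [dist_zero_right] at hz ⊢
  calc ‖F z.1 z.2 - F z.1 (z.2 - τ)‖
      = ‖(F z.1 z.2 - F z.1 (z.2 - σ)) + (F z.1 (z.2 - σ) - F z.1 (z.2 - τ))‖ := by ring_nf
    _ ≤ _ := norm_add_le _ _
    _ < ε := by linarith

/-- For incommensurable steps, the group generated by `a` and `b` is dense, and the asymptotic
periods form a closed group containing it. -/
theorem mem_asymptoticPeriods [PseudoMetricSpace X] [CompactSpace X]
    (h : RenewalFamily p a b κ C F ψ) (hψ : Continuous (fun z : X × ℝ => ψ z.1 z.2))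
    (hab : Irrational (a / b)) (τ : ℝ) : τ ∈ asymptoticPeriods F := by
  have h1 := (dense_addSubgroupClosure_pair_iff.2 hab).closure_eq
  have h2 := closure_minimal (SetLike.coe_subset_coe.2 h.closure_le_asymptoticPeriods)
    (h.isClosed_asymptoticPeriods hψ)
  rw [h1] at h2
  exact h2 (Set.mem_univ τ)

theorem integrable_forcing (h : RenewalFamily p a b κ C F ψ) {x : X} (hψ : Continuous (ψ x)) :
    Integrable (ψ x) :=
  ((integrable_exp_neg_mul_abs h.κ_pos).const_mul C).mono' hψ.aestronglyMeasurable
    (ae_of_all _ (h.decay x))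

/-- Continuous analogue of `hasSum_window`: the renewal equation says that the left side has
derivative `ψ`, and it vanishes at `-∞`. -/
theorem integral_window (h : RenewalFamily p a b κ C F ψ) {x : X} (hψ : Continuous (ψ x))
    (hF : Continuous (F x)) (t : ℝ) :
    p * (∫ τ in (0)..a, F x (t - τ)) + (1 - p : ℝ) * (∫ τ in (0)..b, F x (t - τ)) =
      ∫ s in Set.Iic t, ψ x s := by
  obtain ⟨M, hM⟩ := h.exists_bound
  have hint : ∀ c t : ℝ, ∫ τ in (0)..c, F x (t - τ) =
      (∫ s in (0)..t, F x s) - ∫ s in (0)..(t - c), F x s := by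
    intro c t
    rw [intervalIntegral.integral_comp_sub_left (fun s => F x s), sub_zero,
      intervalIntegral.integral_interval_sub_left (hF.intervalIntegrable _ _)
      (hF.intervalIntegrable _ _)]
  have hder : ∀ c t : ℝ, HasDerivAt (fun t => ∫ τ in (0)..c, F x (t - τ))
      (F x t - F x (t - c)) t := by
    intro c t
    simp_rw [hint]
    have h1 : ∀ t, HasDerivAt (fun u => ∫ s in (0)..u, F x s) (F x t) t := fun t =>
      (hF.integral_hasStrictDerivAt 0 t).hasDerivAt
    exact (h1 t).sub (HasDerivAt.comp_sub_const t c (h1 (t - c)))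
  have hlim : ∀ c : ℝ, Tendsto (fun t => ∫ τ in (0)..c, F x (t - τ)) atBot (𝓝 0) := by
    intro c
    have := intervalIntegral.tendsto_integral_filter_of_dominated_convergence
      (μ := volume) (l := atBot) (F := fun t τ => F x (t - τ)) (f := fun _ => 0) (a := 0) (b := c)
      (fun _ => M) (Eventually.of_forall fun t => by fun_prop)
      (Eventually.of_forall fun t => ae_of_all _ fun τ _ => hM x _)
      (by simp) (ae_of_all _ fun τ _ =>
        (h.bot x).comp (tendsto_atBot_add_const_right _ (-τ) tendsto_id))
    simpa using this
  have := integral_Iic_of_hasDerivAt_of_tendsto' (a := t) (m := (0 : ℂ)) (f' := ψ x)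
    (f := fun t => p * (∫ τ in (0)..a, F x (t - τ)) +
      (1 - p : ℝ) * (∫ τ in (0)..b, F x (t - τ)))
    (fun t _ => ?_) (h.integrable_forcing hψ).integrableOn
    (by simpa using ((hlim a).const_mul (p : ℂ)).add ((hlim b).const_mul ((1 - p : ℝ) : ℂ)))
  · rw [this, sub_zero]
  · refine (((hder a t).const_mul (p : ℂ)).add ((hder b t).const_mul ((1 - p : ℝ) : ℂ))).congr_deriv
      ?_
    have h1 := h.eq x t
    push_cast at h1 ⊢
    linear_combination h1

/-- The renewal theorem for a walk whose two steps are incommensurable. -/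
theorem tendsto_nonlattice [PseudoMetricSpace X] [CompactSpace X]
    (h : RenewalFamily p a b κ C F ψ) (hψ : Continuous (fun z : X × ℝ => ψ z.1 z.2))
    (hF : ∀ x, Continuous (F x)) (hab : Irrational (a / b)) :
    Tendsto (fun z : X × ℝ => ((p * a + (1 - p) * b : ℝ) : ℂ) * F z.1 z.2 -
      ∫ s, ψ z.1 s) (comap Prod.snd atTop) (𝓝 0) := by
  obtain ⟨M, hM⟩ := h.exists_bound
  have hψx : ∀ x, Continuous (ψ x) := fun x => hψ.comp (by fun_prop : Continuous fun t => (x, t))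
  -- Asymptotic invariance for each fixed `τ` suffices: dominated convergence with the bound `2 M`
  -- integrates it over the window.
  have hwin : ∀ c : ℝ, Tendsto (fun z : X × ℝ => ∫ τ in (0)..c, (F z.1 z.2 - F z.1 (z.2 - τ)))
      (comap Prod.snd atTop) (𝓝 0) := by
    intro c
    have := intervalIntegral.tendsto_integral_filter_of_dominated_convergence
      (μ := volume) (l := comap Prod.snd atTop) (F := fun z τ => F z.1 z.2 - F z.1 (z.2 - τ))
      (f := fun _ => 0) (a := 0) (b := c)
      (fun _ => M + M) (Eventually.of_forall fun z => by
        have := hF z.1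
        fun_prop)
      (Eventually.of_forall fun z => ae_of_all _ fun τ _ =>
        (norm_sub_le _ _).trans (add_le_add (hM _ _) (hM _ _)))
      (by simp) (ae_of_all _ fun τ _ => h.mem_asymptoticPeriods hψ hab τ)
    simpa using this
  have htail : Tendsto (fun z : X × ℝ => ∫ s in Set.Ioi z.2, ψ z.1 s)
      (comap Prod.snd atTop) (𝓝 0) := by
    refine squeeze_zero_norm' (a := fun z => (C / κ) * Real.exp (-κ * |z.2|))
      ?_ (tendsto_exp_neg_mul_abs h.κ_pos _)
    rw [eventually_comap_snd_atTop]
    refine ⟨0, fun x t ht => ?_⟩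
    have hi : IntegrableOn (fun s => C * Real.exp (-κ * s)) (Set.Ioi t) :=
      (exp_neg_integrableOn_Ioi t h.κ_pos).const_mul C
    calc ‖∫ s in Set.Ioi t, ψ x s‖ ≤ ∫ s in Set.Ioi t, C * Real.exp (-κ * s) := by
          refine norm_integral_le_of_norm_le hi ?_
          refine (ae_restrict_iff' measurableSet_Ioi).2 (ae_of_all _ fun s hs => ?_)
          have := h.decay x s
          rwa [abs_of_pos (ht.trans_lt hs)] at this
      _ = C / κ * Real.exp (-κ * |t|) := by
          rw [integral_const_mul, integral_exp_mul_Ioi (neg_neg_of_pos h.κ_pos),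
            abs_of_nonneg ht]
          field_simp
  have := (((hwin a).const_mul (p : ℂ)).add ((hwin b).const_mul ((1 - p : ℝ) : ℂ))).sub htail
  simp only [mul_zero, add_zero, sub_zero] at this
  refine this.congr fun z => ?_
  have h1 := h.integral_window (hψx z.1) (hF z.1) z.2
  have h2 := integral_add_compl (measurableSet_Iic (a := z.2)) (h.integrable_forcing (hψx z.1))
  rw [Set.compl_Iic, ← h1] at h2
  have hi : ∀ c, IntervalIntegrable (fun τ => F z.1 (z.2 - τ)) volume 0 c := fun c =>
    ((hF z.1).comp (by fun_prop : Continuous fun τ : ℝ => z.2 - τ)).intervalIntegrable _ _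
  rw [← h2, intervalIntegral.integral_sub (by simp) (hi a),
    intervalIntegral.integral_sub (by simp) (hi b), intervalIntegral.integral_const,
    intervalIntegral.integral_const, Complex.real_smul, Complex.real_smul]
  push_cast
  ring

end RenewalFamily

/-! ### Contour shifts, Laplace transforms and Poisson summation in a strip -/

/-- The closed horizontal strip `|Im w| ≤ θ`. -/
def closedStrip (θ : ℝ) : Set ℂ := {w | |w.im| ≤ θ}

theorem add_mul_I_mem_closedStrip {θ ω : ℝ} (hω : |ω| ≤ θ) (t : ℝ) :
    (t + ω * Complex.I : ℂ) ∈ closedStrip θ := by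
  simpa [closedStrip] using hω

theorem add_ofReal_mem_closedStrip {θ : ℝ} {w : ℂ} (hw : w ∈ closedStrip θ) (t : ℝ) :
    w + (t : ℂ) ∈ closedStrip θ := by
  simpa [closedStrip] using hw

/-- Horizontal contours may be moved within a strip of exponential decay. -/
theorem integral_closedStrip_shift {θ κ C ω : ℝ} {f : ℂ → ℂ} (hκ : 0 < κ)
    (hf : DifferentiableOn ℂ f (closedStrip θ))
    (hC : ∀ w ∈ closedStrip θ, ‖f w‖ ≤ C * Real.exp (-κ * |w.re|)) (hω : |ω| ≤ θ) :
    ∫ t : ℝ, f (t + ω * Complex.I) = ∫ t : ℝ, f t := by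
  have hint : ∀ y : ℝ, |y| ≤ θ → Integrable (fun t : ℝ => f (t + y * Complex.I)) := by
    intro y hy
    refine ((integrable_exp_neg_mul_abs hκ).const_mul C).mono' ?_ (ae_of_all _ fun t => ?_)
    · exact (hf.continuousOn.comp_continuous (by fun_prop)
        (add_mul_I_mem_closedStrip hy)).aestronglyMeasurable
    · simpa using hC _ (add_mul_I_mem_closedStrip hy t)
  have hθ : 0 ≤ θ := (abs_nonneg _).trans hω
  have hrect : ∀ T : ℝ, (∫ x in (-T)..T, f x) - (∫ x in (-T)..T, f (x + ω * Complex.I)) =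
      Complex.I • (∫ y in (0)..ω, f ((-T : ℝ) + y * Complex.I)) -
      Complex.I • (∫ y in (0)..ω, f (T + y * Complex.I)) := by
    intro T
    have := Complex.integral_boundary_rect_eq_zero_of_differentiableOn f ((-T : ℝ) : ℂ)
      (T + ω * Complex.I) (hf.mono ?_)
    · simp only [Complex.ofReal_re, Complex.ofReal_im, Complex.add_re, Complex.add_im,
        Complex.mul_re, Complex.mul_im, Complex.I_re, Complex.I_im, mul_zero, mul_one, zero_mul,
        sub_zero, add_zero, zero_add, Complex.ofReal_zero] at this
      linear_combination this
    · intro w hw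
      have h2 : w.im ∈ Set.uIcc 0 ω := by simpa using hw.2
      have := Set.abs_sub_left_of_mem_uIcc h2
      rw [sub_zero, sub_zero] at this
      exact this.trans hω
  have hedge : ∀ s : ℝ → ℝ, (∀ T, |s T| = |T|) →
      Tendsto (fun T : ℝ => ∫ y in (0)..ω, f ((s T : ℝ) + y * Complex.I)) atTop (𝓝 0) := by
    intro s hs
    have hlim : Tendsto (fun T : ℝ => C * Real.exp (-κ * |T|) * |ω - 0|) atTop
        (𝓝 (C * 0 * |ω - 0|)) :=
      ((Real.tendsto_exp_atBot.comp (tendsto_abs_atTop_atTop.const_mul_atTop_of_neg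
        (neg_neg_of_pos hκ))).const_mul C).mul_const _
    rw [mul_zero, zero_mul] at hlim
    refine squeeze_zero_norm (fun T => ?_) hlim
    refine intervalIntegral.norm_integral_le_of_norm_le_const fun y hy => ?_
    have h1 := Set.abs_sub_left_of_mem_uIcc (Set.uIoc_subset_uIcc hy)
    rw [sub_zero, sub_zero] at h1
    have := hC _ (add_mul_I_mem_closedStrip (h1.trans hω) (s T))
    simpa [hs] using this
  have h1 := (intervalIntegral_tendsto_integral (hint 0 (by simpa using hθ))
    tendsto_neg_atTop_atBot tendsto_id).sub (intervalIntegral_tendsto_integral (hint ω hω)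
    tendsto_neg_atTop_atBot tendsto_id)
  have h2 := ((hedge (fun T => -T) (fun T => abs_neg T)).const_smul Complex.I).sub
    ((hedge (fun T => T) (fun T => rfl)).const_smul Complex.I)
  simp only [Complex.ofReal_zero, zero_mul, add_zero, id, hrect] at h1
  have := tendsto_nhds_unique h1 h2
  rw [smul_zero, sub_zero, sub_eq_zero] at this
  exact this.symm

/-- The bilateral Laplace transform `∫ ψ(t) e^{σ t} dt`. -/
noncomputable def bilateralLaplace (ψ : ℝ → ℂ) (σ : ℂ) : ℂ :=
  ∫ t : ℝ, ψ t * Complex.exp (σ * t)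

theorem bilateralLaplace_eq_shift {θ κ C ω y : ℝ} {ψ : ℂ → ℂ} (hκ : 0 < κ)
    (hψ : DifferentiableOn ℂ ψ (closedStrip θ))
    (hC : ∀ w ∈ closedStrip θ, ‖ψ w‖ ≤ C * Real.exp (-κ * |w.re|)) (hω : |ω| ≤ θ) :
    bilateralLaplace (fun t => ψ t) (y * Complex.I) =
      ∫ t : ℝ, ψ (t + ω * Complex.I) *
        Complex.exp (y * Complex.I * (t + ω * Complex.I)) := by
  refine (integral_closedStrip_shift (C := C * Real.exp (|y| * θ)) hκ
    (f := fun w => ψ w * Complex.exp (y * Complex.I * w))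
    (hψ.mul (by fun_prop)) (fun w hw => ?_) hω).symm
  rw [norm_mul, Complex.norm_exp]
  have h1 : (y * Complex.I * w).re = -(y * w.im) := by simp
  have h2 : -(y * w.im) ≤ |y| * θ := by
    refine (neg_le_abs _).trans ?_
    rw [abs_mul]
    exact mul_le_mul_of_nonneg_left hw (abs_nonneg _)
  rw [h1]
  calc ‖ψ w‖ * Real.exp (-(y * w.im)) ≤
      C * Real.exp (-κ * |w.re|) * Real.exp (|y| * θ) :=
        mul_le_mul (hC w hw) (Real.exp_le_exp.2 h2) (Real.exp_pos _).le
          ((norm_nonneg _).trans (hC w hw))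
    _ = _ := by ring

/-- Moving the contour to height `±θ`, with the sign of `y`, makes the exponential kernel contribute
exactly `e^{-θ|y|}`. -/
theorem norm_bilateralLaplace_le {θ κ C : ℝ} {ψ : ℂ → ℂ} (hκ : 0 < κ) (hθ : 0 ≤ θ)
    (hψ : DifferentiableOn ℂ ψ (closedStrip θ))
    (hC : ∀ w ∈ closedStrip θ, ‖ψ w‖ ≤ C * Real.exp (-κ * |w.re|)) (y : ℝ) :
    ‖bilateralLaplace (fun t => ψ t) (y * Complex.I)‖ ≤
      (∫ t : ℝ, C * Real.exp (-κ * |t|)) * Real.exp (-θ * |y|) := by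
  obtain ⟨ω, hω, hy⟩ : ∃ ω : ℝ, |ω| ≤ θ ∧ y * ω = θ * |y| := by
    rcases le_total 0 y with h | h
    · exact ⟨θ, (abs_of_nonneg hθ).le, by rw [abs_of_nonneg h]; ring⟩
    · exact ⟨-θ, by rw [abs_neg, abs_of_nonneg hθ], by rw [abs_of_nonpos h]; ring⟩
  rw [bilateralLaplace_eq_shift hκ hψ hC hω, ← integral_mul_const]
  refine norm_integral_le_of_norm_le
    (((integrable_exp_neg_mul_abs hκ).const_mul C).mul_const _) (ae_of_all _ fun t => ?_)
  rw [norm_mul, Complex.norm_exp]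
  have h1 : (y * Complex.I * (t + ω * Complex.I)).re = -θ * |y| := by
    simp
    linarith
  rw [h1]
  refine mul_le_mul_of_nonneg_right ?_ (Real.exp_pos _).le
  simpa using hC _ (add_mul_I_mem_closedStrip hω t)

/-- Poisson summation along a horizontal line in the strip. -/
theorem tsum_translates_eq_tsum_laplace {θ κ C ω d : ℝ} {ψ : ℂ → ℂ} (hκ : 0 < κ) (hd : 0 < d)
    (hψ : DifferentiableOn ℂ ψ (closedStrip θ))
    (hC : ∀ w ∈ closedStrip θ, ‖ψ w‖ ≤ C * Real.exp (-κ * |w.re|)) (hω : |ω| ≤ θ) (t : ℝ)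
    (hs : Summable fun k : ℤ =>
      bilateralLaplace (fun t => ψ t) ((-(2 * Real.pi * k / d) : ℝ) * Complex.I) *
      Complex.exp (2 * k * Real.pi * Complex.I * ((t + ω * Complex.I) / d))) :
    d * ∑' j : ℤ, ψ (t + ω * Complex.I + (j * d : ℝ)) = ∑' k : ℤ,
      bilateralLaplace (fun t => ψ t) ((-(2 * Real.pi * k / d) : ℝ) * Complex.I) *
      Complex.exp (2 * k * Real.pi * Complex.I * ((t + ω * Complex.I) / d)) := by
  -- Rescaling by `d` turns the translates into integer ones, so Poisson summation over `ℤ` applies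
  -- at the point `t / d`.
  set f : ℝ → ℂ := fun u => ψ ((d * u : ℝ) + ω * Complex.I) with hf
  have hd' : (d : ℂ) ≠ 0 := by exact_mod_cast hd.ne'
  have hfour : ∀ k : ℤ, (d : ℂ) *
      (FourierTransform.fourier f k * fourier k ((t / d : ℝ) : UnitAddCircle)) =
      bilateralLaplace (fun t => ψ t) ((-(2 * Real.pi * k / d) : ℝ) * Complex.I) *
      Complex.exp (2 * k * Real.pi * Complex.I * ((t + ω * Complex.I) / d)) := by
    intro k
    rw [Real.fourier_real_eq_integral_exp_smul, fourier_coe_apply,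
      bilateralLaplace_eq_shift hκ hψ hC hω]
    have hsub := Measure.integral_comp_mul_left (fun u : ℝ =>
      Complex.exp (((-2 * Real.pi * (u / d) * k : ℝ) : ℂ) * Complex.I) •
        ψ (u + ω * Complex.I)) d
    have h1 : (fun v : ℝ => Complex.exp (((-2 * Real.pi * v * k : ℝ) : ℂ) * Complex.I) • f v) =
        fun v : ℝ => Complex.exp (((-2 * Real.pi * (d * v / d) * k : ℝ) : ℂ) * Complex.I) •
        ψ ((d * v : ℝ) + ω * Complex.I) := by
      funext v
      rw [mul_div_cancel_left₀ _ hd.ne']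
    rw [h1, hsub, abs_of_pos (inv_pos.2 hd), Complex.real_smul, ← mul_assoc, ← mul_assoc,
      Complex.ofReal_inv, mul_inv_cancel₀ hd', one_mul, ← integral_mul_const, ← integral_mul_const]
    congr 1
    funext u
    rw [smul_eq_mul, mul_comm (Complex.exp _) (ψ _), mul_assoc (ψ _), mul_assoc (ψ _), ← Complex.exp_add,
      ← Complex.exp_add]
    congr 2
    push_cast
    field_simp
    ring
  have hbig : f =O[cocompact ℝ] fun x : ℝ => |x| ^ (-2 : ℝ) := by
    obtain ⟨K, hK, hexp⟩ := exp_neg_mul_abs_le (mul_pos hκ hd)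
    refine Asymptotics.IsBigO.of_bound (|C| * K) ?_
    have h0 : ∀ᶠ x : ℝ in cocompact ℝ, 1 ≤ ‖x‖ :=
      tendsto_norm_cocompact_atTop.eventually (eventually_ge_atTop 1)
    filter_upwards [h0] with x hx
    have hx0 : 0 < |x| := by rw [Real.norm_eq_abs] at hx; linarith
    have h2 := hC _ (add_mul_I_mem_closedStrip hω (d * x))
    have h3 : -κ * |d * x| = -(κ * d) * |x| := by rw [abs_mul, abs_of_pos hd]; ring
    simp only [Complex.add_re, Complex.ofReal_re, Complex.mul_re, Complex.I_re, mul_zero,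
      Complex.ofReal_im, Complex.I_im, zero_mul, sub_zero, add_zero] at h2
    rw [h3] at h2
    rw [Real.norm_of_nonneg (Real.rpow_nonneg (abs_nonneg _) _), Real.rpow_neg (abs_nonneg _),
      Real.rpow_two, sq_abs, mul_assoc]
    calc ‖f x‖ ≤ C * Real.exp (-(κ * d) * |x|) := h2
      _ ≤ |C| * (K / (1 + x ^ 2)) := by
        gcongr
        · exact le_abs_self C
        · exact hexp x
      _ ≤ |C| * (K * (x ^ 2)⁻¹) := by
        rw [div_eq_mul_inv]
        have : 0 < x ^ 2 := by rw [← sq_abs]; positivity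
        gcongr
        linarith
  have hcont : Continuous f :=
    hψ.continuousOn.comp_continuous (by fun_prop) fun u => add_mul_I_mem_closedStrip hω (d * u)
  have hFs : Summable fun k : ℤ => FourierTransform.fourier f (k : ℝ) := by
    rw [← summable_norm_iff] at hs ⊢
    refine (hs.mul_left d⁻¹).congr fun k => ?_
    rw [← hfour, fourier_apply, norm_mul, norm_mul, Circle.norm_coe, mul_one,
      Complex.norm_of_nonneg hd.le, inv_mul_cancel_left₀ hd.ne']
  have := Real.tsum_eq_tsum_fourier_of_rpow_decay_of_summable hcont one_lt_two hbig hFs (t / d)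
  simp_rw [← hfour, tsum_mul_left, ← this]
  congr 2
  funext j
  simp only [hf]
  congr 1
  push_cast
  field_simp
  ring

/-- This sum converges locally uniformly up to the edges of the strip, where the Fourier series need
not converge. It therefore furnishes the continuous extension to the boundary rays. -/
theorem continuousOn_tsum_translates {θ κ C d : ℝ} {ψ : ℂ → ℂ} (hκ : 0 < κ) (hd : 0 < d)
    (hψ : ContinuousOn ψ (closedStrip θ))
    (hC : ∀ w ∈ closedStrip θ, ‖ψ w‖ ≤ C * Real.exp (-κ * |w.re|)) :
    ContinuousOn (fun w => ∑' j : ℤ, ψ (w + (j * d : ℝ))) (closedStrip θ) := by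
  have hloc : ∀ R : ℝ, ContinuousOn (fun w => ∑' j : ℤ, ψ (w + (j * d : ℝ)))
      (closedStrip θ ∩ {w | |w.re| < R}) := by
    intro R
    refine continuousOn_tsum (u := fun j : ℤ => |C| * (Real.exp (κ * R) *
      Real.exp (-κ * d) ^ j.natAbs)) (fun j => ?_) ?_ ?_
    · exact hψ.comp (by fun_prop) fun w hw => add_ofReal_mem_closedStrip hw.1 _
    · exact ((summable_pow_natAbs (Real.exp_pos _).le
        (Real.exp_lt_one_iff.2 (by nlinarith))).mul_left _).mul_left _
    · intro j w hw
      refine (hC _ (add_ofReal_mem_closedStrip hw.1 _)).trans ?_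
      have h1 := exp_neg_mul_abs_add_int_le hκ.le hd.le w.re j
      have h2 : |w.re| < R := hw.2
      rw [Complex.add_re, Complex.ofReal_re]
      refine mul_le_mul (le_abs_self C) (h1.trans ?_) (Real.exp_pos _).le (abs_nonneg _)
      gcongr
  intro w hw
  have h1 := hloc (|w.re| + 1) w ⟨hw, by simp⟩
  refine h1.mono_of_mem_nhdsWithin (inter_mem self_mem_nhdsWithin (mem_nhdsWithin_of_mem_nhds ?_))
  exact (isOpen_lt (by fun_prop) continuous_const).mem_nhds (by simp)

/-! ### From the strip to the sector -/

theorem log_mem_closedStrip {θ : ℝ} {z : ℂ} (hz : z ∈ Trie.sector θ) :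
    Complex.log z ∈ closedStrip θ := by
  simpa [closedStrip, Complex.log_im] using hz.2

/-- In polar form `log z = log |z| + i arg z`, so uniformity over the parameter interval is
uniformity over the closed sector. -/
theorem tendsto_sectorAtInfinity {θ : ℝ} {Q : ℂ → ℂ}
    (h : Tendsto (fun z : Set.Icc (-θ) θ × ℝ => Q (z.2 + (z.1 : ℝ) * Complex.I))
      (comap Prod.snd atTop) (𝓝 0)) :
    Tendsto (fun z => Q (Complex.log z)) (Trie.sectorAtInfinity θ) (𝓝 0) := by
  rw [Metric.tendsto_nhds]
  intro ε hε
  obtain ⟨T, hT⟩ := eventually_comap_snd_atTop.1 (h.eventually (Metric.ball_mem_nhds 0 hε))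
  have h1 : ∀ᶠ z in Trie.sectorAtInfinity θ, Real.exp T ≤ ‖z‖ :=
    (tendsto_comap.mono_left inf_le_left).eventually (eventually_ge_atTop _)
  have h2 : ∀ᶠ z in Trie.sectorAtInfinity θ, z ∈ Trie.sector θ :=
    mem_inf_of_right (mem_principal_self _)
  filter_upwards [h1, h2] with z hz1 hz2
  have := hT ⟨z.arg, abs_le.1 hz2.2⟩ (Real.log ‖z‖)
    ((Real.le_log_iff_exp_le (norm_pos_iff.2 hz2.1)).2 hz1)
  exact this

theorem strip_renewalFamily {p θ κ C : ℝ} (hp0 : 0 < p) (hp1 : p < 1) (hκ : 0 < κ)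
    {F ψ : ℂ → ℂ}
    (heq : ∀ w ∈ closedStrip θ, F w = p * F (w + Real.log p) +
      (1 - p : ℝ) * F (w + Real.log (1 - p)) + ψ w)
    (hC : ∀ w ∈ closedStrip θ, ‖ψ w‖ ≤ C * Real.exp (-κ * |w.re|))
    (hbot : ∀ ω : ℝ, |ω| ≤ θ → Tendsto (fun t : ℝ => F (t + ω * Complex.I)) atBot (𝓝 0)) :
    RenewalFamily p (-Real.log p) (-Real.log (1 - p)) κ C
      (fun (x : Set.Icc (-θ) θ) (t : ℝ) => F (t + (x : ℝ) * Complex.I))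
      (fun x t => ψ (t + (x : ℝ) * Complex.I)) where
  p_pos := hp0
  p_lt_one := hp1
  a_pos := neg_pos.2 (Real.log_neg hp0 hp1)
  b_pos := neg_pos.2 (Real.log_neg (by linarith) (by linarith))
  κ_pos := hκ
  eq x t := by
    rw [heq _ (add_mul_I_mem_closedStrip (abs_le.2 x.2) t)]
    push_cast
    ring_nf
  decay x t := by simpa using hC _ (add_mul_I_mem_closedStrip (abs_le.2 x.2) t)
  bot x := hbot x (abs_le.2 x.2)

theorem entropy_pos {p : ℝ} (hp0 : 0 < p) (hp1 : p < 1) : 0 < Trie.entropy p := by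
  have h1 := Real.log_neg hp0 hp1
  have h2 := Real.log_neg (show 0 < 1 - p by linarith) (by linarith)
  unfold Trie.entropy
  nlinarith

/-- In the rational case both logarithms are integer multiples of a common span `d`. -/
theorem exists_span {p : ℝ} (hp0 : 0 < p) (hp1 : p < 1) (hr : Trie.RationalRatio p) :
    ∃ (d : ℝ) (r l : ℕ), 0 < d ∧ r.Coprime l ∧ -Real.log p = r * d ∧ -Real.log (1 - p) = l * d ∧
      Trie.ratioNum p = r ∧ 0 < r := by
  have h1 := Real.log_neg hp0 hp1
  have h2 := Real.log_neg (show 0 < 1 - p by linarith) (by linarith)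
  have hρ := Classical.choose_spec hr
  have hnum : Trie.ratioNum p = (Classical.choose hr).num := by
    unfold Trie.ratioNum
    rw [dif_pos hr]
  set ρ := Classical.choose hr
  have hpos : 0 < ρ := by
    have : (0 : ℝ) < ρ := hρ ▸ div_pos_of_neg_of_neg h1 h2
    exact_mod_cast this
  have hn : 0 < ρ.num := Rat.num_pos.2 hpos
  obtain ⟨r, hrn⟩ := Int.eq_ofNat_of_zero_le hn.le
  have hr0 : 0 < r := by omega
  have hr' : (0 : ℝ) < r := by exact_mod_cast hr0
  have hd0 : (ρ.den : ℝ) ≠ 0 := by exact_mod_cast ρ.den_nz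
  refine ⟨-Real.log p / r, r, ρ.den, div_pos (by linarith) hr', ?_, by field_simp, ?_,
    by rw [hnum, hrn], hr0⟩
  · have := ρ.reduced
    rwa [hrn] at this
  · have h3 : (ρ : ℝ) = r / ρ.den := by
      conv_lhs => rw [Rat.cast_def, hrn]
      simp
    rw [h3, div_eq_div_iff h2.ne hd0] at hρ
    field_simp
    linarith

theorem chi_eq_of_span {p d : ℝ} {r : ℕ} (hd : 0 < d) (har : -Real.log p = r * d)
    (hnum : Trie.ratioNum p = r) (hr0 : 0 < r) (k : ℤ) :
    Trie.chi p k = ((-(2 * Real.pi * k / d) : ℝ) : ℂ) * Complex.I := by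
  have hd' : (d : ℂ) ≠ 0 := by exact_mod_cast hd.ne'
  have hr' : (r : ℂ) ≠ 0 := by exact_mod_cast hr0.ne'
  have h1 : (Real.log p : ℂ) = -(r * d) := by
    rw [← neg_eq_iff_eq_neg]; exact_mod_cast har
  rw [Trie.chi, hnum, h1]
  push_cast
  field_simp

/-- Asymptotics in a sector for solutions of the renewal equation in logarithmic coordinates, with
an analytic forcing term which decays exponentially. -/
theorem renewal_sector_asymptotics {p θ κ C : ℝ} (hp0 : 0 < p) (hp1 : p < 1)
    (hθ0 : 0 < θ) (hθ1 : θ < Real.pi / 2) (hκ : 0 < κ) {F ψ : ℂ → ℂ}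
    (hψ : DifferentiableOn ℂ ψ (closedStrip θ)) (hF : ContinuousOn F (closedStrip θ))
    (heq : ∀ w ∈ closedStrip θ, F w = p * F (w + Real.log p) +
      (1 - p : ℝ) * F (w + Real.log (1 - p)) + ψ w)
    (hC : ∀ w ∈ closedStrip θ, ‖ψ w‖ ≤ C * Real.exp (-κ * |w.re|))
    (hbot : ∀ ω : ℝ, |ω| ≤ θ → Tendsto (fun t : ℝ => F (t + ω * Complex.I)) atBot (𝓝 0))
    {G : ℂ → ℂ} (hG : Trie.RationalRatio p → ∀ k : ℤ, k ≠ 0 →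
      G (-1 + Trie.chi p k) = bilateralLaplace (fun t => ψ t) (Trie.chi p k)) :
    ∃ P : ℂ → ℂ, Trie.IsPeriodicPart p θ G P ∧
      Tendsto (fun z => F (Complex.log z) -
        (bilateralLaplace (fun t => ψ t) 0 / (Trie.entropy p : ℂ) + P z))
        (Trie.sectorAtInfinity θ) (𝓝 0) := by
  have hfam := strip_renewalFamily hp0 hp1 hκ heq hC hbot
  have hent := entropy_pos hp0 hp1
  have hent' : (Trie.entropy p : ℂ) ≠ 0 := by exact_mod_cast hent.ne'
  by_cases hr : Trie.RationalRatio p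
  · obtain ⟨d, r, l, hd, hrl, har, hbl, hnum, hr0⟩ := exists_span hp0 hp1 hr
    have hd' : (d : ℂ) ≠ 0 := by exact_mod_cast hd.ne'
    have hr' : (r : ℂ) ≠ 0 := by exact_mod_cast hr0.ne'
    have hchi := chi_eq_of_span hd har hnum hr0
    have hphase : ∀ z, Trie.phase p z = Complex.log z / d := by
      intro z
      have h1 : (Real.log (1 / p) : ℂ) = r * d := by
        rw [one_div, Real.log_inv]; exact_mod_cast har
      rw [Trie.phase, hnum, h1]
      push_cast
      field_simp
    have hentd : Trie.entropy p = d * (p * r + (1 - p) * l) := by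
      unfold Trie.entropy
      linear_combination p * har + (1 - p) * hbl
    set Φ : ℂ → ℂ := fun w => ∑' j : ℤ, ψ (w + (j * d : ℝ)) with hΦ
    set m := bilateralLaplace (fun t => ψ t) 0 with hm
    set u : ℂ → ℤ → ℂ := fun z k => bilateralLaplace (fun t => ψ t) (Trie.chi p k) *
      Complex.exp (2 * k * Real.pi * Complex.I * Trie.phase p z) with hu
    have hlog : ∀ z : ℂ, Complex.log z = (Real.log ‖z‖ : ℝ) + (z.arg : ℝ) * Complex.I :=
      fun z => rfl
    have hterm : ∀ z (k : ℤ), k ≠ 0 → Trie.fourierTerm p G (Trie.phase p z) k = u z k :=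
      fun z k hk => by rw [Trie.fourierTerm, hG hr k hk]
    have hsub : ∀ z, (Summable fun k : {k : ℤ // k ≠ 0} =>
        Trie.fourierTerm p G (Trie.phase p z) k) ↔ Summable (u z) := by
      intro z
      rw [← (Set.finite_singleton (0 : ℤ)).summable_compl_iff]
      refine summable_congr fun k => hterm z k k.2
    -- Only summability at the given `z` is needed, so the identity also covers boundary points
    -- where the series happens to converge.
    have hpoisson : ∀ z ∈ Trie.sector θ, Summable (u z) →
        d * Φ (Complex.log z) = ∑' k, u z k := by
      intro z hz hs
      simp only [hu, hphase, hchi, hlog z] at hs ⊢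
      exact tsum_translates_eq_tsum_laplace hκ hd hψ hC hz.2 _ hs
    -- The periodic part is defined by the lattice sum rather than by its Fourier series; `m` is the
    -- removed term `k = 0`.
    refine ⟨fun z => (Trie.entropy p : ℂ)⁻¹ * (d * Φ (Complex.log z) - m), ⟨?_, ?_, ?_⟩, ?_⟩
    · have h1 := (continuousOn_tsum_translates hκ hd hψ.continuousOn hC).comp
        (f := Complex.log) (s := Trie.sector θ) (fun z hz => ?_) (fun z hz => log_mem_closedStrip hz)
      · exact ((h1.const_mul (d : ℂ)).sub continuousOn_const).const_mul (Trie.entropy p : ℂ)⁻¹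
      · refine (continuousAt_clog ?_).continuousWithinAt
        rw [Complex.mem_slitPlane_iff_arg]
        refine ⟨fun h => ?_, hz.1⟩
        have := hz.2
        rw [h, abs_of_pos Real.pi_pos] at this
        linarith [Real.pi_pos]
    · intro z hz harg _
      rw [hsub]
      -- The coefficient decays like `e^{-2π θ |k| / d}`, while the exponential grows at most like
      -- `e^{2π |k| |arg z| / d}`. Their product is geometric when `|arg z| < θ`.
      have hρ : Real.exp (-(2 * Real.pi / d * (θ - |z.arg|))) < 1 := by
        rw [Real.exp_lt_one_iff, neg_lt_zero]
        exact mul_pos (by positivity) (by linarith)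
      refine ((summable_pow_natAbs (Real.exp_pos _).le hρ).mul_left
        (∫ t : ℝ, C * Real.exp (-κ * |t|))).of_norm_bounded fun k => ?_
      simp only [hu, hchi, hphase]
      rw [norm_mul, Complex.norm_exp]
      have h1 := norm_bilateralLaplace_le hκ hθ0.le hψ hC (-(2 * Real.pi * k / d))
      have hI : 0 ≤ ∫ t : ℝ, C * Real.exp (-κ * |t|) :=
        nonneg_of_mul_nonneg_left ((norm_nonneg _).trans h1) (Real.exp_pos _)
      have h2 : (2 * k * Real.pi * Complex.I * (Complex.log z / d)).re =
          -(2 * Real.pi / d * (k * z.arg)) := by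
        have : 2 * k * Real.pi * Complex.I * (Complex.log z / d) =
            ((2 * Real.pi / d * k : ℝ) : ℂ) * (Complex.I * Complex.log z) := by
          push_cast
          ring
        rw [this, Complex.re_ofReal_mul, Complex.I_mul_re, Complex.log_im]
        ring
      have h3 : ((k.natAbs : ℕ) : ℝ) = |(k : ℝ)| := by rw [Nat.cast_natAbs]; simp
      rw [h2]
      refine (mul_le_mul_of_nonneg_right h1 (Real.exp_pos _).le).trans ?_
      rw [mul_assoc, ← Real.exp_add, ← Real.exp_nat_mul, h3]
      refine mul_le_mul_of_nonneg_left (Real.exp_le_exp.2 ?_) hI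
      have h4 : |-(2 * Real.pi * k / d)| = 2 * Real.pi / d * |(k : ℝ)| := by
        rw [abs_neg, show 2 * Real.pi * k / d = 2 * Real.pi / d * k by ring, abs_mul,
          abs_of_pos (by positivity)]
      have h5 : -(k * z.arg) ≤ |(k : ℝ)| * |z.arg| := by
        rw [← abs_mul]; exact neg_le_abs _
      rw [h4]
      have h6 : 0 < 2 * Real.pi / d := by positivity
      nlinarith
    · intro z hz hconv
      have hs := (hsub z).1 (hconv hr)
      rw [Trie.periodicPart, if_pos hr, hpoisson z hz hs]
      congr 1
      have h1 := hs.sum_add_tsum_compl (s := {0})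
      rw [← h1, Finset.sum_singleton]
      have h2 : u z 0 = m := by simp [hu, hm, Trie.chi]
      rw [h2, add_sub_cancel_left]
      have h3 : ∑' k : {k : ℤ // k ≠ 0}, Trie.fourierTerm p G (Trie.phase p z) k =
          ∑' k : {k : ℤ // k ≠ 0}, u z k := tsum_congr fun k => hterm z k k.2
      rw [h3]
      have hset : ((({0} : Finset ℤ) : Set ℤ)ᶜ) = {k : ℤ | k ≠ 0} := by ext; simp
      rw [hset]
      rfl
    · have h1 := (hfam.tendsto_lattice hd har hbl hrl).const_mul
        ((d : ℂ) * (Trie.entropy p : ℂ)⁻¹)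
      rw [mul_zero] at h1
      have h2 := tendsto_sectorAtInfinity (θ := θ)
        (Q := fun w => F w - (Trie.entropy p : ℂ)⁻¹ * (d * Φ w)) (h1.congr fun z => ?_)
      · refine h2.congr fun z => ?_
        ring
      · have h3 : (Trie.entropy p : ℂ) = d * ((p * r + (1 - p) * l : ℝ) : ℂ) := by
          rw [hentd]; push_cast; ring
        have h4 : ((p * r + (1 - p) * l : ℝ) : ℂ) ≠ 0 := by
          intro h; rw [h, mul_zero] at h3; exact hent' h3
        have h5 : ∑' j : ℤ, ψ (((z.2 + j * d : ℝ) : ℂ) + (z.1 : ℝ) * Complex.I) =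
            Φ (z.2 + (z.1 : ℝ) * Complex.I) := by
          simp only [hΦ]
          refine tsum_congr fun j => ?_
          congr 1
          push_cast
          ring
        rw [h5, h3]
        field_simp
  · refine ⟨fun _ => 0, ⟨continuousOn_const, fun z _ _ h => (hr h).elim, fun z _ _ => ?_⟩, ?_⟩
    · rw [Trie.periodicPart, if_neg hr]
    · have hirr : Irrational (-Real.log p / -Real.log (1 - p)) := by
        rw [neg_div_neg_eq]
        rintro ⟨ρ, hρ⟩
        exact hr ⟨ρ, hρ.symm⟩
      have h1 := (hfam.tendsto_nonlattice (hψ.continuousOn.comp_continuous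
        (f := fun z : Set.Icc (-θ) θ × ℝ => (z.2 : ℂ) + (z.1 : ℝ) * Complex.I) (by fun_prop)
        fun z => add_mul_I_mem_closedStrip (abs_le.2 z.1.2) z.2)
        (fun x => hF.comp_continuous (by fun_prop) fun t =>
          add_mul_I_mem_closedStrip (abs_le.2 x.2) t) hirr).const_mul (Trie.entropy p : ℂ)⁻¹
      rw [mul_zero] at h1
      refine tendsto_sectorAtInfinity (θ := θ) (Q := fun w => F w -
        (bilateralLaplace (fun t => ψ t) 0 / (Trie.entropy p : ℂ) + 0)) (h1.congr fun z => ?_)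
      have h2 : ∫ s : ℝ, ψ (s + (z.1 : ℝ) * Complex.I) = bilateralLaplace (fun t => ψ t) 0 := by
        rw [integral_closedStrip_shift hκ hψ hC (abs_le.2 z.1.2)]
        simp [bilateralLaplace]
      have h3 : (p * -Real.log p + (1 - p) * -Real.log (1 - p)) = Trie.entropy p := by
        unfold Trie.entropy; ring
      rw [h2, h3]
      field_simp
      ring

/-! ### The smooth ramp that absorbs the logarithm -/

/-- A function asymptotic to `w` at `+∞` and to `0` at `-∞`, analytic for `|Im w| < π`. -/
noncomputable def smoothRamp (w : ℂ) : ℂ := w / (1 + Complex.exp (-w))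

/-- The function `w` for `Re w > 0`, extended by `0`. -/
noncomputable def ramp (w : ℂ) : ℂ := if 0 < w.re then w else 0

/-- The function `a - w` for `0 < Re w ≤ a`, extended by `0`. -/
noncomputable def hinge (a : ℝ) (w : ℂ) : ℂ := if 0 < w.re ∧ w.re ≤ a then a - w else 0

/-- The forcing term for which `smoothRamp` solves the renewal equation. -/
noncomputable def rampForcing (p : ℝ) (w : ℂ) : ℂ :=
  smoothRamp w - p * smoothRamp (w + Real.log p) -
    (1 - p : ℝ) * smoothRamp (w + Real.log (1 - p))

/-- For `|Im w| < π / 2`, the real part of `e^{-w}` is nonnegative, so `1` and `e^{-w}` cannot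
cancel. -/
theorem norm_one_add_exp_neg_ge {θ : ℝ} (hθ : θ < Real.pi / 2) {w : ℂ} (hw : w ∈ closedStrip θ) :
    1 ≤ ‖1 + Complex.exp (-w)‖ ∧ Real.exp (-w.re) ≤ ‖1 + Complex.exp (-w)‖ := by
  have hw' : |w.im| ≤ θ := hw
  have hre : 0 ≤ (Complex.exp (-w)).re := by
    rw [Complex.exp_re, Complex.neg_im, Real.cos_neg]
    refine mul_nonneg (Real.exp_pos _).le (Real.cos_nonneg_of_mem_Icc ?_)
    constructor <;> linarith [abs_le.1 (hw'.trans hθ.le)]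
  constructor
  · refine le_trans ?_ (Complex.re_le_norm _)
    simpa using hre
  · have h1 : Real.exp (-w.re) = ‖Complex.exp (-w)‖ := by rw [Complex.norm_exp, Complex.neg_re]
    rw [h1, Complex.norm_def, Complex.norm_def]
    apply Real.sqrt_le_sqrt
    rw [Complex.normSq_apply, Complex.normSq_apply]
    simp only [Complex.add_re, Complex.add_im, Complex.one_re, Complex.one_im, zero_add]
    nlinarith

theorem one_add_exp_neg_ne_zero {θ : ℝ} (hθ : θ < Real.pi / 2) {w : ℂ}
    (hw : w ∈ closedStrip θ) : 1 + Complex.exp (-w) ≠ 0 := by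
  rw [← norm_pos_iff]
  linarith [(norm_one_add_exp_neg_ge hθ hw).1]

theorem differentiableOn_smoothRamp {θ : ℝ} (hθ : θ < Real.pi / 2) :
    DifferentiableOn ℂ smoothRamp (closedStrip θ) :=
  differentiableOn_id.div (by fun_prop) fun _ hw => one_add_exp_neg_ne_zero hθ hw

theorem mapsTo_add_ofReal_closedStrip (θ t : ℝ) :
    Set.MapsTo (fun w : ℂ => w + (t : ℂ)) (closedStrip θ) (closedStrip θ) :=
  fun _ hw => add_ofReal_mem_closedStrip hw t

theorem differentiableOn_rampForcing {θ : ℝ} (hθ : θ < Real.pi / 2) (p : ℝ) :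
    DifferentiableOn ℂ (rampForcing p) (closedStrip θ) := by
  have h : ∀ t : ℝ, DifferentiableOn ℂ (fun w => smoothRamp (w + (t : ℂ))) (closedStrip θ) :=
    fun t => (differentiableOn_smoothRamp hθ).comp (by fun_prop)
      (mapsTo_add_ofReal_closedStrip θ t)
  exact ((differentiableOn_smoothRamp hθ).sub ((h _).const_mul _)).sub ((h _).const_mul _)

/-- The difference is at most `‖w‖ e^{-|Re w|}`; half of the exponential is spent on absorbing
`‖w‖`. -/
theorem norm_smoothRamp_sub_ramp_le {θ : ℝ} (hθ : θ < Real.pi / 2) {w : ℂ}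
    (hw : w ∈ closedStrip θ) : ‖smoothRamp w - ramp w‖ ≤ 4 * Real.exp (-(1 / 2) * |w.re|) := by
  obtain ⟨h1, h2⟩ := norm_one_add_exp_neg_ge hθ hw
  have hne := one_add_exp_neg_ne_zero hθ hw
  have hw' : |w.im| ≤ θ := hw
  have hn : ‖w‖ ≤ 4 * Real.exp (1 / 2 * |w.re|) := by
    have h3 := Complex.norm_le_abs_re_add_abs_im w
    have h4 := Real.add_one_le_exp (1 / 2 * |w.re|)
    have h5 := Real.pi_lt_four
    have h6 := abs_nonneg w.re
    linarith
  have key : ‖smoothRamp w - ramp w‖ ≤ ‖w‖ * Real.exp (-|w.re|) := by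
    rw [smoothRamp, ramp]
    split_ifs with h
    · have h3 : w / (1 + Complex.exp (-w)) - w =
          -(w * Complex.exp (-w)) / (1 + Complex.exp (-w)) := by
        field_simp
        ring
      rw [h3, norm_div, norm_neg, norm_mul, Complex.norm_exp, Complex.neg_re, abs_of_pos h]
      exact div_le_self (by positivity) h1
    · rw [sub_zero, norm_div, abs_of_nonpos (not_lt.1 h), neg_neg, div_le_iff₀ (by linarith),
        mul_assoc]
      refine le_mul_of_one_le_right (norm_nonneg _) ?_
      calc (1 : ℝ) = Real.exp w.re * Real.exp (-w.re) := by rw [← Real.exp_add]; simp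
        _ ≤ _ := by gcongr
  refine key.trans ((mul_le_mul_of_nonneg_right hn (Real.exp_pos _).le).trans (le_of_eq ?_))
  rw [mul_assoc, ← Real.exp_add]
  ring_nf

theorem norm_hinge_le {θ a : ℝ} (hθ : θ < Real.pi / 2) {w : ℂ} (hw : w ∈ closedStrip θ) :
    ‖hinge a w‖ ≤ (|a| + 2) * Real.exp (1 / 2 * |a|) * Real.exp (-(1 / 2) * |w.re|) := by
  have hw' : |w.im| ≤ θ := hw
  rw [hinge]
  split_ifs with h
  · rw [mul_assoc, ← Real.exp_add, abs_of_pos h.1]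
    have h1 : ‖(a : ℂ) - w‖ ≤ |a| + 2 := by
      refine (Complex.norm_le_abs_re_add_abs_im _).trans ?_
      simp only [Complex.sub_re, Complex.ofReal_re, Complex.sub_im, Complex.ofReal_im, zero_sub,
        abs_neg]
      have h2 : |a - w.re| ≤ |a| := by
        rw [abs_of_nonneg (by linarith), abs_of_nonneg (by linarith)]
        linarith
      linarith [Real.pi_lt_four]
    refine h1.trans (le_mul_of_one_le_right (by positivity) (Real.one_le_exp ?_))
    linarith [le_abs_self a]
  · rw [norm_zero]
    positivity

/-- For the sharp ramp, `ramp(w) - ramp(w - a)` is `a` on `Re w > 0` minus a hinge. Weighting by `p`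
and `q` produces the entropy step; the remaining terms are smoothing errors and hinges, all
exponentially small. -/
theorem rampForcing_eq {p : ℝ} (hp0 : 0 < p) (hp1 : p < 1) (w : ℂ) :
    rampForcing p w - (if 0 < w.re then (Trie.entropy p : ℂ) else 0) =
      ((smoothRamp w - ramp w) -
        p * (smoothRamp (w + Real.log p) - ramp (w + Real.log p)) -
        (1 - p : ℝ) * (smoothRamp (w + Real.log (1 - p)) - ramp (w + Real.log (1 - p)))) -
      p * hinge (-Real.log p) w - (1 - p : ℝ) * hinge (-Real.log (1 - p)) w := by
  have key : ∀ y : ℝ, y < 0 → hinge (-y) w =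
      (if 0 < w.re then (-y : ℂ) else 0) - ramp w + ramp (w + y) := by
    intro y hy
    simp only [hinge, ramp, Complex.add_re, Complex.ofReal_re]
    by_cases h1 : 0 < w.re
    · by_cases h2 : w.re ≤ -y
      · rw [if_pos ⟨h1, h2⟩, if_pos h1, if_pos h1, if_neg (by linarith)]
        push_cast
        ring
      · rw [if_neg (fun h => h2 h.2), if_pos h1, if_pos h1, if_pos (by linarith)]
        ring
    · rw [if_neg (fun h => h1 h.1), if_neg h1, if_neg h1, if_neg (by linarith)]
      ring
  rw [key _ (Real.log_neg hp0 hp1), key _ (Real.log_neg (by linarith) (by linarith)), rampForcing]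
  split_ifs with h
  · simp only [Trie.entropy]
    push_cast
    ring
  · push_cast
    ring

theorem exists_rampForcing_bound {p θ : ℝ} (hp0 : 0 < p) (hp1 : p < 1) (hθ : θ < Real.pi / 2) :
    ∃ K, ∀ w ∈ closedStrip θ, ‖rampForcing p w - (if 0 < w.re then (Trie.entropy p : ℂ) else 0)‖ ≤
      K * Real.exp (-(1 / 2) * |w.re|) := by
  have hshift : ∀ (y : ℝ), ∀ w ∈ closedStrip θ, ‖smoothRamp (w + y) - ramp (w + y)‖ ≤
      4 * Real.exp (1 / 2 * |y|) * Real.exp (-(1 / 2) * |w.re|) := by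
    intro y w hw
    refine (norm_smoothRamp_sub_ramp_le hθ (add_ofReal_mem_closedStrip hw y)).trans ?_
    rw [mul_assoc, ← Real.exp_add]
    gcongr
    rw [Complex.add_re, Complex.ofReal_re]
    have := abs_sub (w.re + y) y
    rw [add_sub_cancel_right] at this
    linarith
  have hh : ∀ (a : ℝ), ∀ w ∈ closedStrip θ, ‖hinge a w‖ ≤
      (|a| + 2) * Real.exp (1 / 2 * |a|) * Real.exp (-(1 / 2) * |w.re|) :=
    fun a w hw => norm_hinge_le hθ hw
  set y₁ := Real.log p
  set y₂ := Real.log (1 - p)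
  refine ⟨4 + p * (4 * Real.exp (1 / 2 * |y₁|)) + (1 - p) * (4 * Real.exp (1 / 2 * |y₂|)) +
    p * ((|(-y₁)| + 2) * Real.exp (1 / 2 * |(-y₁)|)) +
    (1 - p) * ((|(-y₂)| + 2) * Real.exp (1 / 2 * |(-y₂)|)), fun w hw => ?_⟩
  have hn : ∀ z : ℂ, ‖(p : ℂ) * z‖ = p * ‖z‖ := fun z => by
    rw [norm_mul, Complex.norm_of_nonneg hp0.le]
  have hn' : ∀ z : ℂ, ‖((1 - p : ℝ) : ℂ) * z‖ = (1 - p) * ‖z‖ := fun z => by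
    rw [norm_mul, Complex.norm_of_nonneg (by linarith)]
  rw [rampForcing_eq hp0 hp1]
  refine (norm_sub_le _ _).trans ((add_le_add ((norm_sub_le _ _).trans (add_le_add
    ((norm_sub_le _ _).trans (add_le_add (norm_sub_le _ _) le_rfl)) le_rfl)) le_rfl).trans ?_)
  rw [hn, hn, hn', hn']
  have e1 := norm_smoothRamp_sub_ramp_le hθ hw
  have e2 := mul_le_mul_of_nonneg_left (hshift y₁ w hw) hp0.le
  have e3 := mul_le_mul_of_nonneg_left (hshift y₂ w hw) (by linarith : 0 ≤ 1 - p)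
  have e4 := mul_le_mul_of_nonneg_left (hh (-y₁) w hw) hp0.le
  have e5 := mul_le_mul_of_nonneg_left (hh (-y₂) w hw) (by linarith : 0 ≤ 1 - p)
  linarith

theorem integrable_mul_exp {φ : ℝ → ℂ} (hφ : Integrable φ) {σ : ℂ} (hσ : σ.re = 0) :
    Integrable (fun t : ℝ => φ t * Complex.exp (σ * t)) := by
  refine hφ.mono (hφ.aestronglyMeasurable.mul
    (by fun_prop : Continuous fun t : ℝ => Complex.exp (σ * t)).aestronglyMeasurable)
    (ae_of_all _ fun t => ?_)
  rw [norm_mul, Complex.norm_exp]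
  simp [hσ]

theorem bilateralLaplace_sub {φ χ : ℝ → ℂ} (hφ : Integrable φ) (hχ : Integrable χ) {σ : ℂ}
    (hσ : σ.re = 0) : bilateralLaplace (φ - χ) σ =
      bilateralLaplace φ σ - bilateralLaplace χ σ := by
  simp only [bilateralLaplace, Pi.sub_apply, sub_mul]
  exact integral_sub (integrable_mul_exp hφ hσ) (integrable_mul_exp hχ hσ)

theorem bilateralLaplace_const_mul (c : ℂ) (φ : ℝ → ℂ) (σ : ℂ) :
    bilateralLaplace (fun t => c * φ t) σ = c * bilateralLaplace φ σ := by
  simp only [bilateralLaplace, mul_assoc]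
  exact integral_const_mul _ _

theorem bilateralLaplace_comp_add (φ : ℝ → ℂ) (y : ℝ) (σ : ℂ) :
    bilateralLaplace (fun t => φ (t + y)) σ = Complex.exp (-(σ * y)) * bilateralLaplace φ σ := by
  simp only [bilateralLaplace]
  rw [← integral_const_mul, ← integral_add_right_eq_self
    (fun t : ℝ => Complex.exp (-(σ * y)) * (φ t * Complex.exp (σ * t))) y]
  congr 1
  funext t
  rw [mul_left_comm, ← Complex.exp_add]
  congr 2
  push_cast
  ring

theorem closedStrip_ofReal {θ : ℝ} (hθ : 0 ≤ θ) (t : ℝ) : (t : ℂ) ∈ closedStrip θ := by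
  simpa [closedStrip] using hθ

theorem integrable_smoothRamp_sub_ramp :
    Integrable (fun t : ℝ => smoothRamp t - ramp t) := by
  have hm : Measurable (fun t : ℝ => smoothRamp t - ramp t) := by
    have h1 : Continuous (fun t : ℝ => smoothRamp t) :=
      (differentiableOn_smoothRamp (θ := 0) (by positivity)).continuousOn.comp_continuous
        (by fun_prop) (closedStrip_ofReal le_rfl)
    refine h1.measurable.sub ?_
    simp only [ramp, Complex.ofReal_re]
    exact Measurable.ite measurableSet_Ioi (by fun_prop) (by fun_prop)
  refine ((integrable_exp_neg_mul_abs (κ := 1 / 2) (by norm_num)).const_mul 4).mono'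
    hm.aestronglyMeasurable (ae_of_all _ fun t => ?_)
  simpa using norm_smoothRamp_sub_ramp_le (θ := 0) (by positivity) (closedStrip_ofReal le_rfl t)

theorem integrable_hinge (a : ℝ) : Integrable (fun t : ℝ => hinge a t) := by
  have hm : Measurable (fun t : ℝ => hinge a t) := by
    simp only [hinge, Complex.ofReal_re]
    exact Measurable.ite measurableSet_Ioc (by fun_prop) (by fun_prop)
  refine ((integrable_exp_neg_mul_abs (κ := 1 / 2) (by norm_num)).const_mul
    ((|a| + 2) * Real.exp (1 / 2 * |a|))).mono'
    hm.aestronglyMeasurable (ae_of_all _ fun t => ?_)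
  simpa using norm_hinge_le (θ := 0) (a := a) (by positivity) (closedStrip_ofReal le_rfl t)

theorem bilateralLaplace_hinge {a : ℝ} (ha : 0 ≤ a) (σ : ℂ) :
    bilateralLaplace (fun t => hinge a t) σ =
      ∫ t in (0)..a, ((a : ℂ) - t) * Complex.exp (σ * t) := by
  rw [intervalIntegral.integral_of_le ha, ← integral_indicator measurableSet_Ioc, bilateralLaplace]
  congr 1
  funext t
  by_cases h : t ∈ Set.Ioc 0 a
  · rw [Set.indicator_of_mem h, hinge, if_pos (by simpa using h)]
  · rw [Set.indicator_of_notMem h, hinge, if_neg (by simpa using h), zero_mul]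

/-- Source of the term `c (p log² p + q log² q) / (2 h²)` in `hZero`. -/
theorem bilateralLaplace_hinge_zero {a : ℝ} (ha : 0 ≤ a) :
    bilateralLaplace (fun t => hinge a t) 0 = (a : ℂ) ^ 2 / 2 := by
  rw [bilateralLaplace_hinge ha]
  have : ∀ t : ℝ, ((a : ℂ) - t) * Complex.exp (0 * t) = ((a - t : ℝ) : ℂ) := by
    intro t; simp
  simp_rw [this]
  rw [intervalIntegral.integral_ofReal, intervalIntegral.integral_sub (by simp) (by simp)]
  simp
  ring

/-- At the frequencies `χ_k`, the weighted hinges combine to `-h / χ_k`. This produces the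
correction `-c / χ_k` to the Mellin values. -/
theorem bilateralLaplace_hinge_of_exp_eq_one {a : ℝ} (ha : 0 ≤ a) {σ : ℂ} (hσ : σ ≠ 0)
    (he : Complex.exp (σ * a) = 1) :
    bilateralLaplace (fun t => hinge a t) σ = -a / σ := by
  rw [bilateralLaplace_hinge ha]
  have hder : ∀ t ∈ Set.uIcc 0 a, HasDerivAt (fun t : ℝ =>
      ((a : ℂ) - t) * Complex.exp (σ * t) / σ + Complex.exp (σ * t) / σ ^ 2)
      (((a : ℂ) - t) * Complex.exp (σ * t)) t := by
    intro t _
    have h0 : HasDerivAt (fun t : ℝ => (t : ℂ)) 1 t := Complex.ofRealCLM.hasDerivAt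
    have h1 := (h0.const_mul σ).cexp
    refine ((((h0.const_sub (a : ℂ)).mul h1).div_const σ).add (h1.div_const (σ ^ 2))).congr_deriv ?_
    field_simp
    ring
  rw [intervalIntegral.integral_eq_sub_of_hasDerivAt hder
    ((by fun_prop : Continuous fun t : ℝ => ((a : ℂ) - t) * Complex.exp (σ * t)).intervalIntegrable
      _ _), he]
  simp
  ring

theorem integrable_rampForcing {p : ℝ} (hp0 : 0 < p) (hp1 : p < 1) :
    Integrable (fun t : ℝ =>
      rampForcing p t - (if 0 < t then (Trie.entropy p : ℂ) else 0)) := by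
  have h := fun t : ℝ => rampForcing_eq hp0 hp1 (t : ℂ)
  simp only [Complex.ofReal_re] at h
  simp_rw [h]
  have hs : ∀ y : ℝ, Integrable (fun t : ℝ => smoothRamp ((t : ℂ) + y) - ramp ((t : ℂ) + y)) := by
    intro y
    have := integrable_smoothRamp_sub_ramp.comp_add_right y
    simpa using this
  exact (((integrable_smoothRamp_sub_ramp.sub ((hs _).const_mul _)).sub ((hs _).const_mul _)).sub
    ((integrable_hinge _).const_mul _)).sub ((integrable_hinge _).const_mul _)

/-- At such `σ` the transform does not see translation by `log p` or `log q`. Since `1 - p - q = 0`,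
the three smoothing errors cancel and only the hinges remain. -/
theorem bilateralLaplace_rampForcing {p : ℝ} (hp0 : 0 < p) (hp1 : p < 1) {σ : ℂ}
    (hσ : σ.re = 0) (hp : Complex.exp (-(σ * Real.log p)) = 1)
    (hq : Complex.exp (-(σ * Real.log (1 - p))) = 1) :
    bilateralLaplace (fun t : ℝ =>
      rampForcing p t - (if 0 < t then (Trie.entropy p : ℂ) else 0)) σ =
      -(p * bilateralLaplace (fun t => hinge (-Real.log p) t) σ +
        (1 - p : ℝ) * bilateralLaplace (fun t => hinge (-Real.log (1 - p)) t) σ) := by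
  have h := fun t : ℝ => rampForcing_eq hp0 hp1 (t : ℂ)
  simp only [Complex.ofReal_re] at h
  simp_rw [h]
  have hs : ∀ y : ℝ, Integrable (fun t : ℝ => smoothRamp ((t : ℂ) + y) - ramp ((t : ℂ) + y)) := by
    intro y
    have := integrable_smoothRamp_sub_ramp.comp_add_right y
    simpa using this
  have hL : ∀ y : ℝ, Complex.exp (-(σ * y)) = 1 →
      bilateralLaplace (fun t : ℝ => smoothRamp ((t : ℂ) + y) - ramp ((t : ℂ) + y)) σ =
      bilateralLaplace (fun t : ℝ => smoothRamp t - ramp t) σ := by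
    intro y hy
    have := bilateralLaplace_comp_add (fun t : ℝ => smoothRamp t - ramp t) y σ
    simpa [hy] using this
  have i1 := (hs (Real.log p)).const_mul (p : ℂ)
  have i2 := (hs (Real.log (1 - p))).const_mul ((1 - p : ℝ) : ℂ)
  have i3 := (integrable_hinge (-Real.log p)).const_mul (p : ℂ)
  have i4 := (integrable_hinge (-Real.log (1 - p))).const_mul ((1 - p : ℝ) : ℂ)
  have i5 := integrable_smoothRamp_sub_ramp.sub i1
  have i6 := i5.sub i2
  refine (bilateralLaplace_sub (i6.sub i3) i4 hσ).trans ?_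
  rw [bilateralLaplace_sub i6 i3 hσ,
    bilateralLaplace_sub i5 i2 hσ, bilateralLaplace_sub integrable_smoothRamp_sub_ramp i1 hσ,
    bilateralLaplace_const_mul, bilateralLaplace_const_mul, bilateralLaplace_const_mul,
    bilateralLaplace_const_mul, hL _ hp, hL _ hq]
  push_cast
  ring

/-! ### Growth of `g` and the Mellin transform in logarithmic coordinates -/

theorem rpow_mul_log_rpow_le {α ν : ℝ} (h : α < ν) (β : ℝ) :
    ∃ K ≥ 0, ∀ x : ℝ, 1 ≤ x → x ^ α * Real.log (1 + x) ^ β ≤ K * x ^ ν := by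
  suffices H : ∃ K ≥ 0, ∀ x : ℝ, 1 ≤ x → Real.log (1 + x) ^ β ≤ K * x ^ (ν - α) by
    obtain ⟨K, hK, H⟩ := H
    refine ⟨K, hK, fun x hx => ?_⟩
    calc x ^ α * Real.log (1 + x) ^ β ≤ x ^ α * (K * x ^ (ν - α)) :=
          mul_le_mul_of_nonneg_left (H x hx) (by positivity)
      _ = K * (x ^ α * x ^ (ν - α)) := by ring
      _ = K * x ^ ν := by rw [← Real.rpow_add (by linarith)]; ring_nf
  have hε : 0 < ν - α := by linarith
  rcases le_or_gt β 0 with hβ | hβ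
  · refine ⟨Real.log 2 ^ β, by positivity, fun x hx => ?_⟩
    refine (Real.rpow_le_rpow_of_nonpos (show 0 < Real.log 2 from Real.log_pos (by norm_num))
      (Real.log_le_log (by norm_num) (by linarith)) hβ).trans ?_
    exact le_mul_of_one_le_right (by positivity) (Real.one_le_rpow hx hε.le)
  · set δ := (ν - α) / β with hδ
    have hδ0 : 0 < δ := by positivity
    refine ⟨(2 ^ δ / δ) ^ β, by positivity, fun x hx => ?_⟩
    have h1 : Real.log (1 + x) ≤ 2 ^ δ / δ * x ^ δ := by
      calc Real.log (1 + x) ≤ (1 + x) ^ δ / δ := Real.log_le_rpow_div (by linarith) hδ0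
        _ ≤ (2 * x) ^ δ / δ := by gcongr; linarith
        _ = _ := by rw [Real.mul_rpow (by norm_num) (by linarith)]; ring
    have h2 : 0 ≤ Real.log (1 + x) := Real.log_nonneg (by linarith)
    refine (Real.rpow_le_rpow h2 h1 hβ.le).trans (le_of_eq ?_)
    rw [Real.mul_rpow (by positivity) (by positivity), ← Real.rpow_mul (by linarith), hδ,
      div_mul_cancel₀ _ hβ.ne']

theorem SectorBigO_le_rpow {θ α β ν : ℝ} (h : α < ν) {u : ℂ → ℂ} (hu : Trie.SectorBigO θ α β u) :
    ∃ C ≥ 0, ∀ z ∈ Trie.sector θ, 1 ≤ ‖z‖ → ‖u z‖ ≤ C * ‖z‖ ^ ν := by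
  obtain ⟨C, hC⟩ := hu
  obtain ⟨K, hK, hKb⟩ := rpow_mul_log_rpow_le h β
  refine ⟨|C| * K, by positivity, fun z hz hz1 => ?_⟩
  have h0 : 0 ≤ Real.log (1 + ‖z‖) := Real.log_nonneg (by linarith)
  calc ‖u z‖ ≤ C * (‖z‖ ^ α * Real.log (1 + ‖z‖) ^ β) := hC z hz hz1
    _ ≤ |C| * (K * ‖z‖ ^ ν) := by
      refine mul_le_mul (le_abs_self C) (hKb _ hz1) (by positivity) (abs_nonneg _)
    _ = _ := by ring

theorem exists_sub_bound_of_deriv_eq_zero {g : ℂ → ℂ} (hg : Differentiable ℂ g)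
    (h0 : deriv g 0 = 0) : ∃ C ≥ 0, ∀ z : ℂ, ‖z‖ ≤ 1 → ‖g z - g 0‖ ≤ C * ‖z‖ ^ 2 := by
  have hd : ∀ k : ℂ → ℂ, Differentiable ℂ k → Differentiable ℂ (dslope k 0) := fun k hk => by
    rw [← differentiableOn_univ]
    exact (Complex.differentiableOn_dslope univ_mem).2 hk.differentiableOn
  have h1 := hd g hg
  have h2 := hd _ h1
  obtain ⟨C, hC⟩ := (isCompact_closedBall (0 : ℂ) 1).exists_bound_of_continuousOn
    h2.continuous.continuousOn
  refine ⟨C, (norm_nonneg _).trans (hC 0 (by simp)), fun z hz => ?_⟩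
  have e1 : g z - g 0 = z * dslope g 0 z := by
    have := sub_smul_dslope g 0 z
    simpa using this.symm
  have e2 : dslope g 0 z = z * dslope (dslope g 0) 0 z := by
    have := sub_smul_dslope (dslope g 0) 0 z
    rw [dslope_same, h0] at this
    simpa using this.symm
  rw [e1, e2, norm_mul, norm_mul]
  have := hC z (by simpa using hz)
  nlinarith [sq_nonneg ‖z‖]

/-- The function `g(x) - g(0)` with its linear growth `c x` removed on `x > 1`. -/
noncomputable def centeredSubLinear (g : ℂ → ℂ) (c : ℂ) (x : ℝ) : ℂ :=
  Trie.centered g x - if 1 < x then c * x else 0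

/-- Substitute `x = e^t`. The factor `e^{-t}` is the division by `z`, so the line `Re s = -1`
corresponds to the imaginary axis. -/
theorem mellin_eq_bilateralLaplace (u : ℝ → ℂ) (s : ℂ) :
    mellin u s = bilateralLaplace (fun t => u (Real.exp t) * Complex.exp (-t)) (s + 1) := by
  rw [mellin_eq_fourier, Real.fourier_real_eq_integral_exp_smul, bilateralLaplace,
    ← integral_neg_eq_self]
  congr 1
  funext t
  rw [Complex.real_smul, smul_eq_mul, neg_neg]
  push_cast
  rw [← mul_assoc, ← Complex.exp_add, mul_assoc (u _), ← Complex.exp_add, mul_comm]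
  congr 2
  have hs : s = s.re + s.im * Complex.I := (Complex.re_add_im s).symm
  have hpi : (Real.pi : ℂ) ≠ 0 := by exact_mod_cast Real.pi_ne_zero
  conv_rhs => rw [hs]
  field_simp
  ring

theorem exp_mem_sector {θ : ℝ} (hθ : θ < Real.pi / 2) {w : ℂ} (hw : w ∈ closedStrip θ) :
    Complex.exp w ∈ Trie.sector θ := by
  have hw' : |w.im| ≤ θ := hw
  have h1 := abs_le.1 hw'
  refine ⟨Complex.exp_ne_zero _, ?_⟩
  rw [← Complex.log_im, Complex.log_exp (by linarith [Real.pi_pos]) (by linarith [Real.pi_pos])]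
  exact hw'

/-! ### The functional equation as a renewal equation -/

section

variable {p : ℝ} {f g : ℂ → ℂ}

theorem apply_zero_of_functional_eq
    (hfg : ∀ z : ℂ, f z = f ((p : ℂ) * z) + f (((1 - p : ℝ) : ℂ) * z) + g z) : g 0 = -f 0 := by
  have := hfg 0
  simp only [mul_zero] at this
  linear_combination -this

/-- The derivative at `0` is `(1 - p - q) f'(0)`. Its vanishing is what gives the forcing its decay
at `-∞`. -/
theorem deriv_zero_of_functional_eq (hf : Differentiable ℂ f)
    (hfg : ∀ z : ℂ, f z = f ((p : ℂ) * z) + f (((1 - p : ℝ) : ℂ) * z) + g z) : deriv g 0 = 0 := by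
  have hg : g = fun z => f z - f ((p : ℂ) * z) - f (((1 - p : ℝ) : ℂ) * z) := by
    funext z
    linear_combination -hfg z
  have h1 : ∀ a : ℂ, HasDerivAt (fun z => f (a * z)) (deriv f 0 * a) 0 := by
    intro a
    have h2 : HasDerivAt (fun z : ℂ => a * z) a 0 := by
      simpa using (hasDerivAt_id (0 : ℂ)).const_mul a
    have h3 : HasDerivAt f (deriv f 0) (a * 0) := by
      rw [mul_zero]; exact (hf 0).hasDerivAt
    exact h3.comp 0 h2
  rw [hg]
  refine ((((hf 0).hasDerivAt).sub (h1 _)).sub (h1 _)).deriv.trans ?_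
  push_cast
  ring

theorem exists_log_decay {θ α β : ℝ} (hθ1 : θ < Real.pi / 2) (hα : α < 1)
    (hg : Differentiable ℂ g) (hg0 : deriv g 0 = 0) {c : ℂ}
    (hu : Trie.SectorBigO θ α β (fun z => g z - c * z)) :
    ∃ κ > 0, κ ≤ 1 / 2 ∧ ∃ C, ∀ w ∈ closedStrip θ,
      ‖(g (Complex.exp w) - g 0) / Complex.exp w - (if 0 < w.re then c else 0)‖ ≤
        C * Real.exp (-κ * |w.re|) := by
  -- Any exponent strictly between `α` and `1` absorbs the logarithm. Taking it at least `1 / 2`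
  -- also absorbs the constant `g 0` and keeps `κ = 1 - ν` within the ramp's decay rate `1 / 2`.
  set ν := max (1 / 2) ((1 + α) / 2) with hν
  have hν1 : ν < 1 := max_lt (by norm_num) (by linarith)
  have hν2 : 1 / 2 ≤ ν := le_max_left _ _
  have hν3 : α < ν := lt_of_lt_of_le (by linarith) (le_max_right _ _)
  obtain ⟨C₁, hC₁, h₁⟩ := exists_sub_bound_of_deriv_eq_zero hg hg0
  obtain ⟨C₂, hC₂, h₂⟩ := SectorBigO_le_rpow hν3 hu
  refine ⟨1 - ν, by linarith, by linarith, C₁ + C₂ + ‖g 0‖, fun w hw => ?_⟩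
  have hn : ‖Complex.exp w‖ = Real.exp w.re := Complex.norm_exp w
  have hne := Complex.exp_ne_zero w
  split_ifs with h
  · have e1 : (g (Complex.exp w) - g 0) / Complex.exp w - c =
        ((g (Complex.exp w) - c * Complex.exp w) - g 0) / Complex.exp w := by
      field_simp
      ring
    have h3 := h₂ _ (exp_mem_sector hθ1 hw) (by rw [hn]; exact Real.one_le_exp h.le)
    rw [hn, ← Real.exp_mul] at h3
    have h4 : 1 ≤ Real.exp (w.re * ν) := Real.one_le_exp (by positivity)
    rw [e1, norm_div, hn, div_le_iff₀ (Real.exp_pos _), mul_assoc, ← Real.exp_add, abs_of_pos h,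
      show -(1 - ν) * w.re + w.re = w.re * ν by ring]
    calc _ ≤ _ := norm_sub_le _ _
      _ ≤ C₂ * Real.exp (w.re * ν) + ‖g 0‖ * Real.exp (w.re * ν) :=
        add_le_add h3 (le_mul_of_one_le_right (norm_nonneg _) h4)
      _ ≤ _ := by nlinarith [norm_nonneg (g 0)]
  · have h' : w.re ≤ 0 := not_lt.1 h
    have h3 := h₁ (Complex.exp w) (by rw [hn]; exact Real.exp_le_one_iff.2 h')
    rw [hn] at h3
    rw [sub_zero, norm_div, hn, div_le_iff₀ (Real.exp_pos _), mul_assoc, ← Real.exp_add,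
      abs_of_nonpos h']
    calc _ ≤ C₁ * Real.exp w.re ^ 2 := h3
      _ ≤ C₁ * Real.exp (-(1 - ν) * -w.re + w.re) := by
        rw [← Real.exp_nat_mul]
        gcongr
        push_cast
        nlinarith
      _ ≤ _ := by
        refine mul_le_mul_of_nonneg_right ?_ (Real.exp_pos _).le
        linarith [norm_nonneg (g 0)]

theorem tendsto_smoothRamp_log_sub {θ : ℝ} (hθ1 : θ < Real.pi / 2) :
    Tendsto (fun z => smoothRamp (Complex.log z) - Complex.log z) (Trie.sectorAtInfinity θ)
      (𝓝 0) := by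
  refine tendsto_sectorAtInfinity (Q := fun w => smoothRamp w - w) (squeeze_zero_norm'
    (a := fun z => 4 * Real.exp (-(1 / 2) * |z.2|)) ?_ (tendsto_exp_neg_mul_abs (by norm_num) _))
  rw [eventually_comap_snd_atTop]
  refine ⟨1, fun x t ht => ?_⟩
  have := norm_smoothRamp_sub_ramp_le hθ1 (add_mul_I_mem_closedStrip (abs_le.2 x.2) t)
  have hre : ((t : ℂ) + (x : ℝ) * Complex.I).re = t := by simp
  rw [ramp, if_pos (by rw [hre]; linarith), hre] at this
  exact this

theorem tendsto_const_div_sectorAtInfinity (θ : ℝ) (a : ℂ) :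
    Tendsto (fun z => a / z) (Trie.sectorAtInfinity θ) (𝓝 0) := by
  have h1 : Trie.sectorAtInfinity θ ≤ Bornology.cobounded ℂ := by
    rw [← comap_norm_atTop]
    exact inf_le_left
  have := (tendsto_inv₀_cobounded.mono_left h1).const_mul a
  simpa [div_eq_mul_inv] using this

theorem exp_chi_eq_one (hp0 : 0 < p) (hp1 : p < 1) (hr : Trie.RationalRatio p) (k : ℤ) :
    Complex.exp (Trie.chi p k * Real.log p) = 1 ∧
      Complex.exp (Trie.chi p k * Real.log (1 - p)) = 1 := by
  obtain ⟨d, r, l, hd, hrl, har, hbl, hnum, hr0⟩ := exists_span hp0 hp1 hr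
  have hd' : (d : ℂ) ≠ 0 := by exact_mod_cast hd.ne'
  have key : ∀ (y : ℝ) (n : ℕ), -y = n * d → Complex.exp (Trie.chi p k * y) = 1 := by
    intro y n hy
    rw [Complex.exp_eq_one_iff]
    refine ⟨k * n, ?_⟩
    have : (y : ℂ) = -(n * d) := by rw [← neg_eq_iff_eq_neg]; exact_mod_cast hy
    rw [chi_eq_of_span hd har hnum hr0, this]
    push_cast
    field_simp
  exact ⟨key _ r har, key _ l hbl⟩

theorem chi_ne_zero (hp0 : 0 < p) (hp1 : p < 1) (hr : Trie.RationalRatio p) {k : ℤ} (hk : k ≠ 0) :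
    Trie.chi p k ≠ 0 ∧ (Trie.chi p k).re = 0 := by
  obtain ⟨d, r, l, hd, hrl, har, hbl, hnum, hr0⟩ := exists_span hp0 hp1 hr
  rw [chi_eq_of_span hd har hnum hr0]
  refine ⟨mul_ne_zero ?_ Complex.I_ne_zero, Complex.re_ofReal_mul _ _ |>.trans (by simp)⟩
  have : (k : ℝ) ≠ 0 := by exact_mod_cast hk
  have := Real.pi_ne_zero
  exact_mod_cast neg_ne_zero.2 (by positivity)

/-- The asymptotic expansion in terms of the Mellin transform of `centeredSubLinear g c`. -/
theorem sector_asymptotics (hp0 : 0 < p) (hp1 : p < 1) (hf : Differentiable ℂ f)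
    (hg : Differentiable ℂ g)
    (hfg : ∀ z : ℂ, f z = f ((p : ℂ) * z) + f (((1 - p : ℝ) : ℂ) * z) + g z)
    {θ α β : ℝ} (hθ0 : 0 < θ) (hθ1 : θ < Real.pi / 2) (hα : α < 1) {c : ℂ}
    (hu : Trie.SectorBigO θ α β (fun z => g z - c * z)) {G : ℂ → ℂ}
    (hG : Trie.RationalRatio p → ∀ k : ℤ, k ≠ 0 → G (-1 + Trie.chi p k) =
      mellin (centeredSubLinear g c) (-1 + Trie.chi p k) - c / Trie.chi p k) :
    ∃ P : ℂ → ℂ, Trie.IsPeriodicPart p θ G P ∧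
      Tendsto (fun z : ℂ => f z / z -
        (deriv f 0 + c / (Trie.entropy p : ℂ) * Complex.log z +
          Trie.hZero p c (mellin (centeredSubLinear g c) (-1)) + P z))
        (Trie.sectorAtInfinity θ) (𝓝 0) := by
  have hent : (Trie.entropy p : ℂ) ≠ 0 := by exact_mod_cast (entropy_pos hp0 hp1).ne'
  have hg0 := deriv_zero_of_functional_eq hf hfg
  have hgf := apply_zero_of_functional_eq hfg
  obtain ⟨κ, hκ, hκ2, C, hC⟩ := exists_log_decay hθ1 hα hg hg0 hu
  obtain ⟨K, hK⟩ := exists_rampForcing_bound hp0 hp1 hθ1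
  -- The ramp's forcing tends to the entropy, so this multiple cancels the limit `c` of `ψ₀` at
  -- `+∞`.
  set c' := c / (Trie.entropy p : ℂ) with hc'
  set F : ℂ → ℂ := fun w => (f (Complex.exp w) - f 0 - deriv f 0 * Complex.exp w) / Complex.exp w -
    c' * smoothRamp w with hF
  set ψ₀ : ℂ → ℂ := fun w => (g (Complex.exp w) - g 0) / Complex.exp w with hψ₀
  set ψ : ℂ → ℂ := fun w => ψ₀ w - c' * rampForcing p w with hψ
  have hψ₀d : Differentiable ℂ ψ₀ :=
    ((hg.comp Complex.differentiable_exp).sub_const _).div Complex.differentiable_exp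
      Complex.exp_ne_zero
  have hψd : DifferentiableOn ℂ ψ (closedStrip θ) :=
    hψ₀d.differentiableOn.sub ((differentiableOn_rampForcing hθ1 p).const_mul _)
  have hFc : ContinuousOn F (closedStrip θ) := by
    have h1 : Continuous fun w => (f (Complex.exp w) - f 0 - deriv f 0 * Complex.exp w) /
        Complex.exp w := by
      have := hf.continuous
      exact Continuous.div (by fun_prop) (by fun_prop) Complex.exp_ne_zero
    exact h1.continuousOn.sub ((differentiableOn_smoothRamp hθ1).continuousOn.const_mul c')
  -- The inserted steps cancel because `c' h = c`, and each bracket decays on its own.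
  have hsplit : ∀ w, ψ w = (ψ₀ w - (if 0 < w.re then c else 0)) -
      c' * (rampForcing p w - (if 0 < w.re then (Trie.entropy p : ℂ) else 0)) := by
    intro w
    simp only [hψ, hc']
    split_ifs
    · field_simp
      ring
    · ring
  have hdecay : ∀ w ∈ closedStrip θ, ‖ψ w‖ ≤ (|C| + ‖c'‖ * |K|) * Real.exp (-κ * |w.re|) := by
    intro w hw
    rw [hsplit]
    have h1 : Real.exp (-(1 / 2) * |w.re|) ≤ Real.exp (-κ * |w.re|) := by
      gcongr
    calc _ ≤ _ := norm_sub_le _ _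
      _ ≤ |C| * Real.exp (-κ * |w.re|) + ‖c'‖ * (|K| * Real.exp (-κ * |w.re|)) := by
        rw [norm_mul]
        gcongr
        · exact (hC w hw).trans (by gcongr; exact le_abs_self C)
        · exact (hK w hw).trans (by gcongr; exact le_abs_self K)
      _ = _ := by ring
  have heq : ∀ w ∈ closedStrip θ, F w = p * F (w + Real.log p) +
      (1 - p : ℝ) * F (w + Real.log (1 - p)) + ψ w := by
    intro w _
    have hq0 : 0 < 1 - p := by linarith
    have hexp : ∀ y : ℝ, 0 < y → Complex.exp (w + Real.log y) = y * Complex.exp w := by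
      intro y hy
      rw [Complex.exp_add, ← Complex.ofReal_exp, Real.exp_log hy, mul_comm]
    have hp' : (p : ℂ) ≠ 0 := by exact_mod_cast hp0.ne'
    have hq' : ((1 - p : ℝ) : ℂ) ≠ 0 := by exact_mod_cast hq0.ne'
    have hne := Complex.exp_ne_zero w
    simp only [hF, hψ, hψ₀, rampForcing, hexp p hp0, hexp (1 - p) hq0, hgf]
    have h1 := hfg (Complex.exp w)
    have hsum : (p : ℂ) + ((1 - p : ℝ) : ℂ) = 1 := by push_cast; ring
    generalize ((1 - p : ℝ) : ℂ) = q at *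
    field_simp
    rw [mul_comm (p : ℂ), mul_comm q] at h1
    linear_combination h1 + deriv f 0 * Complex.exp w * hsum
  have hbot : ∀ ω : ℝ, |ω| ≤ θ → Tendsto (fun t : ℝ => F (t + ω * Complex.I)) atBot (𝓝 0) := by
    intro ω hω
    have h1 : Tendsto (fun t : ℝ => Complex.exp (t + ω * Complex.I)) atBot (𝓝[≠] 0) := by
      refine tendsto_nhdsWithin_iff.2 ⟨?_, Eventually.of_forall fun t => Complex.exp_ne_zero _⟩
      rw [tendsto_zero_iff_norm_tendsto_zero]
      simpa [Complex.norm_exp] using Real.tendsto_exp_atBot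
    have h2 : Tendsto (fun z => (f z - f 0 - deriv f 0 * z) / z) (𝓝[≠] 0) (𝓝 0) := by
      have h3 := (hasDerivAt_iff_tendsto_slope.1 (hf 0).hasDerivAt).sub_const (deriv f 0)
      rw [sub_self] at h3
      refine h3.congr' ?_
      filter_upwards [self_mem_nhdsWithin] with z hz
      have hz' : z ≠ 0 := hz
      rw [slope_def_field, sub_zero]
      field_simp
    have h3 : Tendsto (fun t : ℝ => smoothRamp (t + ω * Complex.I)) atBot (𝓝 0) := by
      have h4 : Tendsto (fun t : ℝ => 4 * Real.exp (-(1 / 2) * |t|)) atBot (𝓝 (4 * 0)) :=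
        (Real.tendsto_exp_atBot.comp
          (tendsto_abs_atBot_atTop.const_mul_atTop_of_neg (by norm_num))).const_mul 4
      rw [mul_zero] at h4
      refine squeeze_zero_norm' ?_ h4
      filter_upwards [eventually_le_atBot 0] with t ht
      have := norm_smoothRamp_sub_ramp_le hθ1 (add_mul_I_mem_closedStrip hω t)
      have hre : ((t : ℂ) + ω * Complex.I).re = t := by simp
      rwa [ramp, hre, if_neg (by linarith), sub_zero] at this
    simpa using (h2.comp h1).sub (h3.const_mul c')
  have hmellin : ∀ s : ℂ, mellin (centeredSubLinear g c) s =
      bilateralLaplace (fun t : ℝ => ψ₀ t - (if 0 < t then c else 0)) (s + 1) := by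
    intro s
    rw [mellin_eq_bilateralLaplace]
    congr 1
    funext t
    simp only [centeredSubLinear, Trie.centered, hψ₀, Complex.ofReal_exp, Real.one_lt_exp_iff]
    rw [Complex.exp_neg]
    have := Complex.exp_ne_zero t
    split_ifs <;> (field_simp; try ring)
  have hint₀ : Integrable (fun t : ℝ => ψ₀ t - (if 0 < t then c else 0)) := by
    have hm : Measurable (fun t : ℝ => ψ₀ t - (if 0 < t then c else 0)) :=
      (hψ₀d.continuous.comp Complex.continuous_ofReal).measurable.sub
        (Measurable.ite measurableSet_Ioi (by fun_prop) (by fun_prop))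
    refine ((integrable_exp_neg_mul_abs hκ).const_mul C).mono' hm.aestronglyMeasurable
      (ae_of_all _ fun t => ?_)
    simpa using hC t (closedStrip_ofReal hθ0.le t)
  -- The exponential conditions hold for `σ = χ_k` in the rational case and always for `σ = 0`, so
  -- the mean value is treated uniformly.
  have hlaplace : ∀ σ : ℂ, σ.re = 0 → Complex.exp (σ * Real.log p) = 1 →
      Complex.exp (σ * Real.log (1 - p)) = 1 → bilateralLaplace (fun t => ψ t) σ =
        mellin (centeredSubLinear g c) (-1 + σ) + c' *
          (p * bilateralLaplace (fun t => hinge (-Real.log p) t) σ +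
            (1 - p : ℝ) * bilateralLaplace (fun t => hinge (-Real.log (1 - p)) t) σ) := by
    intro σ hσ h1 h2
    have h3 := fun t : ℝ => hsplit t
    simp only [Complex.ofReal_re] at h3
    simp_rw [h3]
    refine (bilateralLaplace_sub hint₀ ((integrable_rampForcing hp0 hp1).const_mul c') hσ).trans ?_
    rw [bilateralLaplace_const_mul, bilateralLaplace_rampForcing hp0 hp1 hσ
      (by rw [Complex.exp_neg, h1, inv_one]) (by rw [Complex.exp_neg, h2, inv_one]), hmellin,
      neg_add_cancel_comm]
    ring
  have hlogp := Real.log_neg hp0 hp1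
  have hlogq := Real.log_neg (show 0 < 1 - p by linarith) (by linarith)
  obtain ⟨P, hP, hlim⟩ := renewal_sector_asymptotics hp0 hp1 hθ0 hθ1 hκ hψd hFc heq hdecay hbot
    (G := G) (fun hr k hk => by
      obtain ⟨h1, h2⟩ := exp_chi_eq_one hp0 hp1 hr k
      obtain ⟨h3, h4⟩ := chi_ne_zero hp0 hp1 hr hk
      rw [hG hr k hk, hlaplace _ h4 h1 h2, bilateralLaplace_hinge_of_exp_eq_one (by linarith) h3,
        bilateralLaplace_hinge_of_exp_eq_one (by linarith) h3, hc']
      · have he : (Trie.entropy p : ℂ) =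
            -p * Real.log p - (1 - p : ℝ) * Real.log (1 - p) := by
          simp only [Trie.entropy]
          push_cast
          ring
        field_simp
        rw [he]
        push_cast
        ring
      · push_cast
        rw [mul_neg, Complex.exp_neg, h2, inv_one]
      · push_cast
        rw [mul_neg, Complex.exp_neg, h1, inv_one])
  refine ⟨P, hP, ?_⟩
  have h0 := hlaplace 0 rfl (by simp) (by simp)
  rw [bilateralLaplace_hinge_zero (by linarith), bilateralLaplace_hinge_zero (by linarith),
    add_zero] at h0
  have hz0 : Trie.hZero p c (mellin (centeredSubLinear g c) (-1)) =
      bilateralLaplace (fun t => ψ t) 0 / (Trie.entropy p : ℂ) := by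
    rw [h0, Trie.hZero, hc']
    push_cast
    field_simp
  -- Restore what `F` omits: the smooth ramp is replaced by `log z`, and `f 0 / z` tends to `0`.
  have hsum := (hlim.add ((tendsto_smoothRamp_log_sub hθ1).const_mul c')).add
    (tendsto_const_div_sectorAtInfinity θ (f 0))
  rw [mul_zero, add_zero, add_zero] at hsum
  have hmem : ∀ᶠ z in Trie.sectorAtInfinity θ, z ∈ Trie.sector θ :=
    mem_inf_of_right (mem_principal_self _)
  refine hsum.congr' ?_
  filter_upwards [hmem] with z hz
  have hz' : z ≠ 0 := hz.1
  rw [hz0]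
  simp only [hF, Complex.exp_log hz']
  field_simp
  ring

end

/-! ### Convergence and continuation of the Mellin transform -/

theorem ofReal_mem_sector {θ : ℝ} (hθ0 : 0 < θ) {x : ℝ} (hx : 0 < x) : (x : ℂ) ∈ Trie.sector θ :=
  ⟨by exact_mod_cast hx.ne', by rw [Complex.arg_ofReal_of_nonneg hx.le, abs_zero]; exact hθ0.le⟩

theorem centeredSubLinear_zero (g : ℂ → ℂ) : centeredSubLinear g 0 = Trie.centered g := by
  funext x
  simp [centeredSubLinear]

section

variable {g : ℂ → ℂ} {c : ℂ} {θ α β : ℝ}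

theorem locallyIntegrableOn_centered (hg : Differentiable ℂ g) :
    LocallyIntegrableOn (Trie.centered g) (Set.Ioi 0) := by
  have h := hg.continuous
  have : Continuous (Trie.centered g) := by
    unfold Trie.centered
    fun_prop
  exact this.locallyIntegrable.locallyIntegrableOn _

theorem locallyIntegrableOn_centeredSubLinear (hg : Differentiable ℂ g) (c : ℂ) :
    LocallyIntegrableOn (centeredSubLinear g c) (Set.Ioi 0) := by
  have h1 : Continuous (fun x : ℝ => c * (x : ℂ)) := by fun_prop
  have h2 := (h1.locallyIntegrable (μ := volume)).indicator (measurableSet_Ioi (a := (1 : ℝ)))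
  have h3 : (fun x : ℝ => if 1 < x then c * (x : ℂ) else 0) =
      (Set.Ioi 1).indicator (fun x : ℝ => c * (x : ℂ)) := by
    funext x
    simp [Set.indicator]
  refine (locallyIntegrableOn_centered hg).sub ?_
  rw [h3]
  exact h2.locallyIntegrableOn _

theorem isBigO_centeredSubLinear_atTop (hθ0 : 0 < θ)
    (hu : Trie.SectorBigO θ α β (fun z => g z - c * z)) {ν : ℝ} (hν : max α 0 < ν) :
    centeredSubLinear g c =O[atTop] (fun x : ℝ => x ^ (-(-ν))) := by
  obtain ⟨C, hC, h⟩ := SectorBigO_le_rpow ((le_max_left _ _).trans_lt hν) hu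
  refine Asymptotics.IsBigO.of_bound (C + ‖g 0‖) ?_
  filter_upwards [eventually_gt_atTop 1] with x hx
  have hx0 : 0 < x := by linarith
  have hn : ‖(x : ℂ)‖ = x := Complex.norm_of_nonneg hx0.le
  have h1 := h x (ofReal_mem_sector hθ0 hx0) (by rw [hn]; exact hx.le)
  rw [hn] at h1
  have h2 : 1 ≤ x ^ ν := Real.one_le_rpow hx.le ((le_max_right _ _).trans hν.le)
  rw [neg_neg, Real.norm_of_nonneg (by positivity), centeredSubLinear, Trie.centered, if_pos hx,
    show g x - g 0 - c * x = (g x - c * x) - g 0 by ring]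
  calc _ ≤ _ := norm_sub_le _ _
    _ ≤ C * x ^ ν + ‖g 0‖ * x ^ ν := add_le_add h1 (le_mul_of_one_le_right (norm_nonneg _) h2)
    _ = _ := by ring

theorem isBigO_centeredSubLinear_zero (hg : Differentiable ℂ g) (hg0 : deriv g 0 = 0) (c : ℂ) :
    centeredSubLinear g c =O[𝓝[>] 0] (fun x : ℝ => x ^ (-(-2 : ℝ))) := by
  obtain ⟨C, hC, h⟩ := exists_sub_bound_of_deriv_eq_zero hg hg0
  refine Asymptotics.IsBigO.of_bound C ?_
  filter_upwards [Ioo_mem_nhdsGT (zero_lt_one' ℝ)] with x hx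
  have hn : ‖(x : ℂ)‖ = x := Complex.norm_of_nonneg hx.1.le
  have h1 := h x (by rw [hn]; exact hx.2.le)
  rw [hn] at h1
  rw [neg_neg, Real.rpow_two, Real.norm_of_nonneg (by positivity), centeredSubLinear, Trie.centered,
    if_neg (by linarith [hx.2]), sub_zero]
  exact h1

theorem mellinConvergent_centeredSubLinear (hθ0 : 0 < θ) (hg : Differentiable ℂ g)
    (hg0 : deriv g 0 = 0) (hu : Trie.SectorBigO θ α β (fun z => g z - c * z)) {s : ℂ}
    (hs : -2 < s.re) (hs' : s.re < -max α 0) : MellinConvergent (centeredSubLinear g c) s := by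
  obtain ⟨ν, h1, h2⟩ := exists_between (show max α 0 < -s.re by linarith)
  exact mellinConvergent_of_isBigO_rpow (locallyIntegrableOn_centeredSubLinear hg c)
    (isBigO_centeredSubLinear_atTop hθ0 hu h1) (by linarith)
    (isBigO_centeredSubLinear_zero hg hg0 c) hs

theorem differentiableAt_mellin_centeredSubLinear (hθ0 : 0 < θ) (hg : Differentiable ℂ g)
    (hg0 : deriv g 0 = 0) (hu : Trie.SectorBigO θ α β (fun z => g z - c * z)) {s : ℂ}
    (hs : -2 < s.re) (hs' : s.re < -max α 0) :
    DifferentiableAt ℂ (mellin (centeredSubLinear g c)) s := by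
  obtain ⟨ν, h1, h2⟩ := exists_between (show max α 0 < -s.re by linarith)
  exact mellin_differentiableAt_of_isBigO_rpow (locallyIntegrableOn_centeredSubLinear hg c)
    (isBigO_centeredSubLinear_atTop hθ0 hu h1) (by linarith)
    (isBigO_centeredSubLinear_zero hg hg0 c) hs

theorem mellinConvergent_centered (hθ0 : 0 < θ) (hα : α < 1) (hg : Differentiable ℂ g)
    (hg0 : deriv g 0 = 0) (hu : Trie.SectorBigO θ α β (fun z => g z - c * z)) {s : ℂ}
    (hs : -2 < s.re) (hs' : s.re < -1) : MellinConvergent (Trie.centered g) s := by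
  have h0 := isBigO_centeredSubLinear_zero hg hg0 0
  rw [centeredSubLinear_zero] at h0
  refine mellinConvergent_of_isBigO_rpow (locallyIntegrableOn_centered hg) (a := -1) ?_ hs' h0 hs
  have h1 := isBigO_centeredSubLinear_atTop hθ0 hu (ν := 1) (max_lt hα one_pos)
  have h2 : (fun x : ℝ => if 1 < x then c * (x : ℂ) else 0) =O[atTop]
      (fun x : ℝ => x ^ (-(-1 : ℝ))) := by
    refine Asymptotics.IsBigO.of_bound ‖c‖ ?_
    filter_upwards [eventually_gt_atTop 1] with x hx
    rw [if_pos hx, norm_mul, neg_neg, Real.rpow_one, Complex.norm_real]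
  refine (h1.add h2).congr_left fun x => ?_
  rw [centeredSubLinear, sub_add_cancel]

/-- The removed piece `c x` on `x > 1` has Mellin transform `-c / (s + 1)` for `Re s < -1`. The
right side then makes sense on the larger strip and gives the continuation. -/
theorem mellin_centered_eq (hθ0 : 0 < θ) (hα : α < 1) (hg : Differentiable ℂ g)
    (hg0 : deriv g 0 = 0) (hu : Trie.SectorBigO θ α β (fun z => g z - c * z)) {s : ℂ}
    (hs : -2 < s.re) (hs' : s.re < -1) :
    mellin (Trie.centered g) s = mellin (centeredSubLinear g c) s - c / (s + 1) := by
  have h1 := mellinConvergent_centered hθ0 hα hg hg0 hu hs hs'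
  have h2 := mellinConvergent_centeredSubLinear hθ0 hg hg0 hu hs
    (hs'.trans_le (neg_le_neg (max_le hα.le zero_le_one)))
  have h3 := (hasMellin_sub h1 h2).2
  have h4 : mellin (fun t => Trie.centered g t - centeredSubLinear g c t) s = -c / (s + 1) := by
    have h5 : ∀ t : ℝ, t ∈ Set.Ioi (0 : ℝ) → (t : ℂ) ^ (s - 1) •
        (Trie.centered g t - centeredSubLinear g c t) =
        (Set.Ioi (1 : ℝ)).indicator (fun t : ℝ => c * (t : ℂ) ^ s) t := by
      intro t ht
      have ht' : (t : ℂ) ≠ 0 := by exact_mod_cast (Set.mem_Ioi.1 ht).ne'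
      simp only [centeredSubLinear, sub_sub_cancel, Set.indicator, Set.mem_Ioi, smul_eq_mul]
      split_ifs
      · rw [Complex.cpow_sub _ _ ht', Complex.cpow_one]
        field_simp
      · rw [mul_zero]
    rw [mellin, setIntegral_congr_fun measurableSet_Ioi h5, setIntegral_indicator measurableSet_Ioi,
      Set.inter_eq_self_of_subset_right (Set.Ioi_subset_Ioi zero_le_one), integral_const_mul,
      integral_Ioi_cpow_of_lt hs' one_pos]
    simp
    ring
  rw [h4] at h3
  linear_combination -h3

theorem isOpen_re_strip (a b : ℝ) : IsOpen {s : ℂ | a < s.re ∧ s.re < b} :=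
  (isOpen_lt continuous_const Complex.continuous_re).inter
    (isOpen_lt Complex.continuous_re continuous_const)

theorem isPreconnected_re_strip (a b : ℝ) : IsPreconnected {s : ℂ | a < s.re ∧ s.re < b} :=
  ((convex_halfSpace_re_gt a).inter (convex_halfSpace_re_lt b)).isPreconnected

theorem analyticAt_mellin_centeredSubLinear (hθ0 : 0 < θ) (hg : Differentiable ℂ g)
    (hg0 : deriv g 0 = 0) (hu : Trie.SectorBigO θ α β (fun z => g z - c * z)) {s : ℂ}
    (hs : -2 < s.re) (hs' : s.re < -max α 0) :
    AnalyticAt ℂ (mellin (centeredSubLinear g c)) s :=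
  DifferentiableOn.analyticAt (s := {s : ℂ | -2 < s.re ∧ s.re < -max α 0})
    (fun _ h => (differentiableAt_mellin_centeredSubLinear hθ0 hg hg0 hu
      h.1 h.2).differentiableWithinAt) ((isOpen_re_strip _ _).mem_nhds ⟨hs, hs'⟩)

theorem analyticAt_continuation (hθ0 : 0 < θ) (hg : Differentiable ℂ g)
    (hg0 : deriv g 0 = 0) (hu : Trie.SectorBigO θ α β (fun z => g z - c * z)) {s : ℂ}
    (hs : -2 < s.re) (hs' : s.re < -max α 0) (hne : s ≠ -1) :
    AnalyticAt ℂ (fun s => mellin (centeredSubLinear g c) s - c / (s + 1)) s := by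
  have h1 := analyticAt_mellin_centeredSubLinear hθ0 hg hg0 hu hs hs'
  have h2 : s + 1 ≠ 0 := fun h => hne (eq_neg_of_add_eq_zero_left h)
  have h3 : AnalyticAt ℂ (fun s : ℂ => c / (s + 1)) s :=
    analyticAt_const.div (analyticAt_id.add analyticAt_const) h2
  exact h1.sub h3

theorem meromorphicOn_continuation (hθ0 : 0 < θ) (hg : Differentiable ℂ g)
    (hg0 : deriv g 0 = 0) (hu : Trie.SectorBigO θ α β (fun z => g z - c * z)) :
    MeromorphicOn (fun s => mellin (centeredSubLinear g c) s - c / (s + 1))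
      {s : ℂ | -2 < s.re ∧ s.re < -max α 0} := by
  intro s hs
  have h1 := (analyticAt_mellin_centeredSubLinear hθ0 hg hg0 hu hs.1 hs.2).meromorphicAt
  have h3 : MeromorphicAt (fun s : ℂ => c / (s + 1)) s :=
    (MeromorphicAt.const c s).div
      (analyticAt_id.add analyticAt_const : AnalyticAt ℂ (fun s : ℂ => s + 1) s).meromorphicAt
  exact h1.sub h3

theorem exists_mellinContinuation (hθ0 : 0 < θ) (hα : α < 1) (hg : Differentiable ℂ g)
    (hg0 : deriv g 0 = 0) (hu : Trie.SectorBigO θ α β (fun z => g z - c * z)) :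
    ∃ G, Trie.IsMellinContinuation (Trie.centered g) (-2) (-1) (-max α 0) G := by
  have hm := meromorphicOn_continuation hθ0 hg hg0 hu
  have hα' : -1 < -max α 0 := neg_lt_neg (max_lt hα one_pos)
  -- The explicit formula has a junk value at `s = -1`, so it is normalized; this changes nothing
  -- where it is already analytic.
  refine ⟨toMeromorphicNFOn _ _, fun s h1 h2 => mellinConvergent_centered hθ0 hα hg hg0 hu h1 h2,
    fun s h1 h2 => ?_, meromorphicNFOn_toMeromorphicNFOn
      (fun s => mellin (centeredSubLinear g c) s - c / (s + 1))
      {s : ℂ | -2 < s.re ∧ s.re < -max α 0}⟩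
  have hs : s ∈ {s : ℂ | -2 < s.re ∧ s.re < -max α 0} := ⟨h1, h2.trans hα'⟩
  have hne : s ≠ -1 := fun h => by rw [h] at h2; simp at h2
  rw [toMeromorphicNFOn_eq_toMeromorphicNFAt hm hs, toMeromorphicNFAt_eq_self.2
    (analyticAt_continuation hθ0 hg hg0 hu hs.1 hs.2 hne).meromorphicNFAt,
    mellin_centered_eq hθ0 hα hg hg0 hu h1 h2]

/-- Uniqueness of the meromorphic continuation, up to values at isolated points. -/
theorem mellinContinuation_eventuallyEq (hθ0 : 0 < θ) (hα : α < 1) (hg : Differentiable ℂ g)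
    (hg0 : deriv g 0 = 0) (hu : Trie.SectorBigO θ α β (fun z => g z - c * z)) {G : ℂ → ℂ}
    (hG : Trie.IsMellinContinuation (Trie.centered g) (-2) (-1) (-max α 0) G) {s : ℂ}
    (hs : -2 < s.re) (hs' : s.re < -max α 0) :
    G =ᶠ[𝓝[≠] s] fun s => mellin (centeredSubLinear g c) s - c / (s + 1) := by
  have hα' : -1 < -max α 0 := neg_lt_neg (max_lt hα one_pos)
  have hD := hG.meromorphic.meromorphicOn.sub (meromorphicOn_continuation hθ0 hg hg0 hu)
  -- Any point of the convergence strip would do. The difference vanishes near it, and infinite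
  -- meromorphic order propagates over the connected larger strip.
  set x₀ : ℂ := ((-3 / 2 : ℝ) : ℂ) with hx₀
  have hx₀s : -2 < x₀.re ∧ x₀.re < -1 := by
    rw [hx₀, Complex.ofReal_re]
    norm_num
  have htop : meromorphicOrderAt (G - fun s => mellin (centeredSubLinear g c) s - c / (s + 1))
      x₀ = ⊤ := by
    rw [meromorphicOrderAt_eq_top_iff]
    refine eventually_nhdsWithin_of_eventually_nhds ?_
    filter_upwards [(isOpen_re_strip (-2) (-1)).mem_nhds hx₀s] with s hs
    rw [Pi.sub_apply, hG.eq_mellin s hs.1 hs.2, mellin_centered_eq hθ0 hα hg hg0 hu hs.1 hs.2,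
      sub_self]
  have horder : meromorphicOrderAt (G - fun s => mellin (centeredSubLinear g c) s - c / (s + 1))
      s = ⊤ := by
    by_contra hne
    exact hD.meromorphicOrderAt_ne_top_of_isPreconnected (isPreconnected_re_strip _ _)
      (x := s) ⟨hs, hs'⟩ ⟨hx₀s.1, hx₀s.2.trans hα'⟩ hne htop
  filter_upwards [meromorphicOrderAt_eq_top_iff.1 horder] with z hz
  exact sub_eq_zero.1 hz

/-- Functions in normal form that agree on a punctured neighbourhood agree at the centre as well.
This fixes the values of `G` at `-1 + χ_k`. -/
theorem mellinContinuation_eventuallyEq_nhds (hθ0 : 0 < θ) (hα : α < 1) (hg : Differentiable ℂ g)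
    (hg0 : deriv g 0 = 0) (hu : Trie.SectorBigO θ α β (fun z => g z - c * z)) {G : ℂ → ℂ}
    (hG : Trie.IsMellinContinuation (Trie.centered g) (-2) (-1) (-max α 0) G) {s : ℂ}
    (hs : -2 < s.re) (hs' : s.re < -max α 0) (hne : s ≠ -1) :
    G =ᶠ[𝓝 s] fun s => mellin (centeredSubLinear g c) s - c / (s + 1) :=
  ((hG.meromorphic ⟨hs, hs'⟩).eventuallyEq_nhdsNE_iff_eventuallyEq_nhds
    (analyticAt_continuation hθ0 hg hg0 hu hs hs' hne).meromorphicNFAt).1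
    (mellinContinuation_eventuallyEq hθ0 hα hg hg0 hu hG hs hs')

end

/-! ### The two cases of the theorem -/

theorem proposition2 (p : ℝ) (hp0 : 0 < p) (hp1 : p < 1) (f g : ℂ → ℂ)
    (hf : Differentiable ℂ f) (hg : Differentiable ℂ g)
    (hfg : ∀ z : ℂ, f z = f ((p : ℂ) * z) + f (((1 - p : ℝ) : ℂ) * z) + g z)
    (θ α β : ℝ) (hθ0 : 0 < θ) (hθ1 : θ < Real.pi / 2) (hα : α < 1) :
    (Trie.SectorBigO θ α β g →
      (∀ s : ℂ, -2 < s.re → s.re < -max α 0 → MellinConvergent (Trie.centered g) s) ∧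
      ∃ P : ℂ → ℂ, Trie.IsPeriodicPart p θ (mellin (Trie.centered g)) P ∧
        Tendsto
          (fun z : ℂ => f z / z -
            (deriv f 0 + mellin (Trie.centered g) (-1) / (Trie.entropy p : ℂ) + P z))
          (Trie.sectorAtInfinity θ) (𝓝 0)) ∧
    (∀ c : ℂ, Trie.SectorBigO θ α β (fun z => g z - c * z) →
      (∃ G : ℂ → ℂ, Trie.IsMellinContinuation (Trie.centered g) (-2) (-1) (-max α 0) G) ∧
      ∀ G : ℂ → ℂ, Trie.IsMellinContinuation (Trie.centered g) (-2) (-1) (-max α 0) G →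
        (∀ s : ℂ, -2 < s.re → s.re < -max α 0 → s ≠ -1 → AnalyticAt ℂ G s) ∧
        ∃ c₀ : ℂ, Tendsto (fun s : ℂ => G s + c / (s + 1)) (𝓝[≠] (-1)) (𝓝 c₀) ∧
          ∃ P : ℂ → ℂ, Trie.IsPeriodicPart p θ G P ∧
            Tendsto
              (fun z : ℂ => f z / z -
                (deriv f 0 + c / (Trie.entropy p : ℂ) * Complex.log z +
                  Trie.hZero p c c₀ + P z))
              (Trie.sectorAtInfinity θ) (𝓝 0)) := by
  have hg0 := deriv_zero_of_functional_eq hf hfg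
  have hα' : (-1 : ℝ) < -max α 0 := neg_lt_neg (max_lt hα one_pos)
  refine ⟨fun hu => ?_, fun c hu => ⟨exists_mellinContinuation hθ0 hα hg hg0 hu, fun G hG => ?_⟩⟩
  · have hu' : Trie.SectorBigO θ α β (fun z => g z - 0 * z) := by simpa using hu
    refine ⟨fun s h1 h2 => ?_, ?_⟩
    · rw [← centeredSubLinear_zero]
      exact mellinConvergent_centeredSubLinear hθ0 hg hg0 hu' h1 h2
    · obtain ⟨P, hP, hlim⟩ := sector_asymptotics hp0 hp1 hf hg hfg hθ0 hθ1 hα hu'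
        (G := mellin (Trie.centered g)) (fun _ k _ => by
          rw [centeredSubLinear_zero, zero_div, sub_zero])
      refine ⟨P, hP, hlim.congr fun z => ?_⟩
      simp [Trie.hZero, centeredSubLinear_zero]
  · have heq := fun {s : ℂ} => mellinContinuation_eventuallyEq_nhds hθ0 hα hg hg0 hu hG (s := s)
    -- Adding `c / (s + 1)` cancels the polar part of `G`, so `c₀` is the value at `-1` of the
    -- analytic remainder.
    refine ⟨fun s h1 h2 hne => ?_, mellin (centeredSubLinear g c) (-1), ?_, ?_⟩
    · exact (analyticAt_continuation hθ0 hg hg0 hu h1 h2 hne).congr (heq h1 h2 hne).symm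
    · have h1 := (analyticAt_mellin_centeredSubLinear hθ0 hg hg0 hu (s := -1) (by norm_num)
        (by simpa using hα')).continuousAt.tendsto.mono_left
        (nhdsWithin_le_nhds (s := {(-1 : ℂ)}ᶜ))
      refine h1.congr' ?_
      filter_upwards [mellinContinuation_eventuallyEq hθ0 hα hg hg0 hu hG (s := -1) (by norm_num)
        (by simpa using hα')] with s hs
      rw [hs, sub_add_cancel]
    · refine sector_asymptotics hp0 hp1 hf hg hfg hθ0 hθ1 hα hu fun hr k hk => ?_
      obtain ⟨h1, h2⟩ := chi_ne_zero hp0 hp1 hr hk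
      have hre : (-1 + Trie.chi p k).re = -1 := by simp [h2]
      rw [(heq (by rw [hre]; norm_num) (by rw [hre]; exact hα')
        (fun h => h1 (by simpa using h))).eq_of_nhds, neg_add_cancel_comm]
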